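/- Let $S^2\subset\mathbb R^3$ be the unit sphere with round metric $g$, area form $\mu$ (outward orientation), Laplace–Beltrami operator $\Delta$ and Poisson bracket $\{f,h\}\,\mu=\mathrm df\wedge\mathrm dh$ on $C^\infty(S^2)$. Let $\mathfrak X_\mu(S^2)$ be the Lie algebra of smooth divergence-free vector fields with the commutator, and let $X_\psi=\{\psi,\cdot\}\in\mathfrak X_\mu(S^2)$ be the field with stream function $\psi$. Let $\mathfrak f=\mathfrak X_\mu(S^2)\times C^\infty(S^2)$ be the Abelian extension with bracket $$[(v,\sigma),(w,\tau)]=\bigl([v,w],\;v(\tau)-w(\sigma)-\mu(v,w)\bigr),$$ so that $v(\sigma)=\{\psi,\sigma\}$ for $v=X_\psi$, and $\mu(X_\psi,X_\varphi)=\{\psi,\varphi\}$. Let $\mathfrak f^*$ be its smooth dual, consisting of the functionals $(v,\sigma)\mapsto\int_{S^2}(r\sigma+\theta(v))\mu$ with $r$ a smooth function and $\theta$ a smooth 1-form. Let $\mathcal F=\mathfrak f\ltimes\mathfrak f^*$ be the semidirect product with $$[(v,a),(w,c)]=([v,w],\,\mathrm{ad}^*_wa-\mathrm{ad}^*_vc),\qquad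 \langle\mathrm{ad}^*_x l,y\rangle=\langle l,[x,y]\rangle .$$ Its dual is $\mathcal F^*=\mathfrak f\times\mathfrak f^*$, with $\langle(w,b),(v,a)\rangle=b(v)+a(w)$. For $\kappa>0$ let $I_\kappa\colon\mathfrak f\to\mathfrak f^*$ be the operator $\langle I_\kappa(v,\sigma),(w,\tau)\rangle=\int_{S^2}(\kappa\,\sigma\tau+g(v,w))\,\mu$. For a function $h$ on $\mathcal F^*$, the differential of $h$ at $m$ is an element $\mathrm dh(m)\in\mathcal F$ with $\frac{\mathrm d}{\mathrm ds}\big|_{s=0}h(m+s\delta)=\langle\delta,\mathrm dh(m)\rangle$ for all $\delta\in\mathcal F^*$. A curve $m(t)\in\mathcal F^*$ is a trajectory of the Lie–Poisson system with Hamiltonian $h$ if $\dot m=\mathrm{ad}^*_{\mathrm dh(m)}m$, that is, $\frac{\mathrm d}{\mathrm dt}\langle m,y\rangle=\langle m,[\mathrm dh(m),y]\rangle$ for all $y\in\mathcal F$. **Theorem.** Let $J\subset\mathbb R$ be an open interval and let $\psi,\rho,q,\xi\colon J\times S^2\to\mathbb R$ be smooth. Consider the system of axisymmetric MHD equations on $J\times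 S^2$ $$\begin{aligned} \Delta\dot\psi&=\{\Delta\psi,\psi\}+\{\xi,\Delta\xi\}+2\{q,\psi\}+2\{\xi,\rho\},&\qquad \dot\rho&=\{\rho,\psi\}+\{\xi,q\}+2\{\psi,\xi\},\\ \dot q&=\{q,\psi\}+\{\xi,\rho\},& \dot\xi&=\{\xi,\psi\}. \end{aligned}\tag{LP3D}$$ 1. (Lie–Poisson form.) Let $h(w,b)=\tfrac12\langle I_4w,w\rangle+\tfrac12\langle b,I_4^{-1}b\rangle$ on $\mathcal F^*$, where the second term means $\sup_{v\in\mathfrak f}\bigl(b(v)-\tfrac12\langle I_4v,v\rangle\bigr)$. Then $(\psi,\rho,q,\xi)$ solves (LP3D) if and only if the curve $m=\bigl((X_\xi,\tfrac12\rho),\,I_4(X_\psi,\tfrac12 q)\bigr)$ in $\mathcal F^*$ is a trajectory of the Lie–Poisson system with Hamiltonian $h$ and $\int_{S^2}\xi\,\mu$ is constant in time. (The last condition is only there because $X_\xi$ determines $\xi$ up to an additive constant.) Moreover, for every quadruple $(\psi,\rho,q,\xi)$ as above and every $t\in J$, $h(m)$ is the energy $$H=-\tfrac12\int_{S^2}(\psi\Delta\psi-q^2)\mu-\tfrac12\int_{S^2}(\xi\Delta\xi-\rho^2)\mu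 .$$ 2. (Euler–Arnold form.) $(\psi,\rho,q,\xi)$ solves (LP3D) if and only if $\int_{S^2}\xi\,\mu$ is constant in time and $\frac{\mathrm d}{\mathrm dt}m=\mathrm{ad}^*_{x}m$ on $\mathcal F^*$ (tested against every $y\in\mathcal F$), where $m=\bigl((X_\xi,\rho),\,I_1(X_\psi,q)\bigr)$ and $x=\bigl((X_\beta,\alpha),\,I_1(X_\delta,\gamma)\bigr)\in\mathcal F$ with $\beta=\psi$, $\delta=\xi$, $\alpha=q-\psi$, $\gamma=\rho+\xi$. -/

import Mathlib

open MeasureTheory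
open scoped Manifold ContDiff

namespace AxiMHD

noncomputable section

abbrev E3 := EuclideanSpace ℝ (Fin 3)
/-- The unit sphere `S²` in `ℝ³`. -/
abbrev S2 := Metric.sphere (0 : E3) 1
/-- The algebra `C^∞(S²)`. -/
abbrev SmoothFn := C^∞⟮𝓡 2, S2; ℝ⟯

/-- The standard basis of `ℝ³`. -/
def ebasis (i : Fin 3) : E3 := EuclideanSpace.single i 1

open Classical in
/-- The extension `y ↦ f(y / |y|)` of `f` from `S²` to `ℝ³ ∖ {0}`. -/
def radialExt (f : S2 → ℝ) (y : E3) : ℝ :=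
  if h : y = 0 then 0 else f ⟨‖y‖⁻¹ • y, by simp [norm_smul, h]⟩

theorem radialExt_coe (f : S2 → ℝ) (x : S2) : radialExt f x = f x := by
  have hx : ‖(x : E3)‖ = 1 := norm_eq_of_mem_sphere x
  have h0 : (x : E3) ≠ 0 := by
    intro h; simp [h] at hx
  simp only [radialExt, h0, dif_neg, not_false_eq_true]
  congr 1
  ext1
  simp [hx]

theorem radialExt_smul (f : S2 → ℝ) {c : ℝ} (hc : 0 < c) (y : E3) : radialExt f (c • y) = radialExt f y := by
  by_cases h : y = 0
  · simp [h]
  · have h' : c • y ≠ 0 := smul_ne_zero hc.ne' h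
    simp only [radialExt, h, h', dif_neg, not_false_eq_true]
    congr 1
    ext1
    simp only [norm_smul, Real.norm_eq_abs, abs_of_pos hc, smul_smul]
    congr 1
    field_simp

theorem contDiffAt_radialExt (f : SmoothFn) {y : E3} (hy : y ≠ 0) : ContDiffAt ℝ ∞ (radialExt f) y := by
  have : Fact (Module.finrank ℝ E3 = 2 + 1) := ⟨by simp⟩
  let U : TopologicalSpace.Opens E3 := ⟨{0}ᶜ, isOpen_compl_singleton⟩
  have hN : ContMDiff 𝓘(ℝ, E3) 𝓘(ℝ, E3) ∞ (fun z : U => ‖(z : E3)‖⁻¹ • (z : E3)) := by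
    intro z
    have hz : (z : E3) ≠ 0 := z.2
    refine (contMDiffAt_subtype_iff (f := fun z : E3 => ‖z‖⁻¹ • z)).2 ?_
    refine ContDiffAt.contMDiffAt ?_
    exact ((contDiffAt_norm ℝ hz).inv (norm_ne_zero_iff.2 hz)).smul contDiffAt_id
  have hmem : ∀ z : U, ‖(z : E3)‖⁻¹ • (z : E3) ∈ Metric.sphere (0 : E3) 1 := by
    intro z
    have hz : (z : E3) ≠ 0 := z.2
    simp [norm_smul, hz]
  have hc := f.contMDiff.comp (ContMDiff.codRestrict_sphere (n := 2) hN hmem)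
  have h2 : ContMDiffAt 𝓘(ℝ, E3) 𝓘(ℝ, ℝ) ∞ (fun z : U => radialExt f z) ⟨y, hy⟩ := by
    convert! hc.contMDiffAt using 1
    funext z
    have hz : (z : E3) ≠ 0 := z.2
    simp [radialExt, hz, Set.codRestrict]
  exact (contMDiffAt_subtype_iff.1 h2).contDiffAt

theorem coe_ne_zero (x : S2) : (x : E3) ≠ 0 := by
  intro h
  have := norm_eq_of_mem_sphere x
  simp [h] at this

/-- The restriction to `S²` of a function on `ℝ³` that is smooth near `S²`. -/
def ofAmbient (g : E3 → ℝ) (hg : ∀ x : S2, ContDiffAt ℝ ∞ g x) : SmoothFn :=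
  have : Fact (Module.finrank ℝ E3 = 2 + 1) := ⟨by simp⟩
  ⟨fun x => g x, fun x => ((hg x).contMDiffAt.comp x contMDiff_coe_sphere.contMDiffAt)⟩

@[simp] theorem ofAmbient_apply (g : E3 → ℝ) (hg : ∀ x : S2, ContDiffAt ℝ ∞ g x) (x : S2) :
    ofAmbient g hg x = g x := rfl

theorem radialExt_add (f g : SmoothFn) : radialExt (⇑f + ⇑g) = radialExt f + radialExt g := by
  funext y; by_cases h : y = 0 <;> simp [radialExt, h]
theorem radialExt_mul (f g : SmoothFn) : radialExt (⇑f * ⇑g) = radialExt f * radialExt g := by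
  funext y; by_cases h : y = 0 <;> simp [radialExt, h]
theorem radialExt_const_smul (c : ℝ) (f : SmoothFn) : radialExt (c • ⇑f) = c • radialExt f := by
  funext y; by_cases h : y = 0 <;> simp [radialExt, h]
theorem differentiableAt_radialExt (f : SmoothFn) (x : S2) : DifferentiableAt ℝ (radialExt f) x :=
  (contDiffAt_radialExt f (coe_ne_zero x)).differentiableAt (by simp)

/-- The `i`-th component of the tangential gradient on `S²`: the restriction to `S²` of the `i`-th
partial derivative of the radially constant extension. -/
def D (i : Fin 3) : Derivation ℝ SmoothFn SmoothFn :=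
  Derivation.mk'
    { toFun := fun f => ofAmbient (fun y => fderiv ℝ (radialExt f) y (ebasis i)) fun x =>
        ((contDiffAt_radialExt f (coe_ne_zero x)).fderiv_right (m := ∞) (by simp)).clm_apply
          contDiffAt_const
      map_add' := fun f g => by
        ext x
        simp [radialExt_add, fderiv_add (differentiableAt_radialExt f x) (differentiableAt_radialExt g x)]
      map_smul' := fun c f => by
        ext x
        simp [radialExt_const_smul, fderiv_const_smul (differentiableAt_radialExt f x)] }
    (fun f g => by
      ext x
      simp [radialExt_mul, fderiv_mul (differentiableAt_radialExt f x) (differentiableAt_radialExt g x), radialExt_coe])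

theorem D_apply (i : Fin 3) (f : SmoothFn) (x : S2) :
    D i f x = fderiv ℝ (radialExt f) x (ebasis i) := rfl

/-- The restriction to `S²` of the `i`-th coordinate function of `ℝ³`. -/
def coord (i : Fin 3) : SmoothFn :=
  ofAmbient (fun y => y i) fun x => by fun_prop

theorem fderiv_radialExt_smul (f : SmoothFn) {c : ℝ} (hc : 0 < c) (y : E3) :
    fderiv ℝ (radialExt f) (c • y) = c⁻¹ • fderiv ℝ (radialExt f) y := by
  have h : (fun z => radialExt f (c • z)) = radialExt f := funext fun z => radialExt_smul f hc z
  have h2 := fderiv_comp_smul (f := radialExt f) c (x := y)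
  rw [h] at h2
  rw [h2, smul_smul, inv_mul_cancel₀ hc.ne', one_smul]

theorem radialExt_ofAmbient (g : E3 → ℝ) (hg : ∀ x : S2, ContDiffAt ℝ ∞ g x) {y : E3} (hy : y ≠ 0) :
    radialExt ⇑(ofAmbient g hg) y = g (‖y‖⁻¹ • y) := by
  simp [radialExt, hy]

theorem radialExt_D (i : Fin 3) (f : SmoothFn) {y : E3} (hy : y ≠ 0) :
    radialExt ⇑(D i f) y = ‖y‖ * fderiv ℝ (radialExt f) y (ebasis i) := by
  have h := radialExt_ofAmbient (fun y => fderiv ℝ (radialExt f) y (ebasis i)) (fun x =>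
        ((contDiffAt_radialExt f (coe_ne_zero x)).fderiv_right (m := ∞) (by simp)).clm_apply
          contDiffAt_const) hy
  refine h.trans ?_
  rw [fderiv_radialExt_smul f (by positivity)]
  simp

theorem sum_coord_mul_D (f : SmoothFn) : ∑ i, coord i * D i f = 0 := by
  ext x
  have h1 : HasDerivAt (fun s : ℝ => radialExt f (s • (x : E3))) (fderiv ℝ (radialExt f) x x) 1 := by
    have := (differentiableAt_radialExt f x).hasFDerivAt
    have h2 : HasDerivAt (fun s : ℝ => s • (x : E3)) (x : E3) 1 := by
      simpa using (hasDerivAt_id (1:ℝ)).smul_const (x : E3)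
    exact HasFDerivAt.comp_hasDerivAt (1:ℝ) (by simpa using this) h2
  have h3 : HasDerivAt (fun s : ℝ => radialExt f (s • (x : E3))) 0 1 := by
    refine (hasDerivAt_const (1:ℝ) (radialExt f x)).congr_of_eventuallyEq ?_
    filter_upwards [lt_mem_nhds (show (0:ℝ) < 1 by norm_num)] with s hs
    exact radialExt_smul f hs _
  have h4 := h1.unique h3
  have h5 : (x : E3) = ∑ i, (x : E3) i • ebasis i := by
    ext j; fin_cases j <;> simp [ebasis, Fin.sum_univ_three]
  have h6 : fderiv ℝ (radialExt f) x (∑ i, (x : E3) i • ebasis i) = 0 := by rw [← h5]; exact h4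
  rw [map_sum] at h6
  simp only [map_smul, smul_eq_mul] at h6
  simpa [coord, D_apply, Fin.sum_univ_three] using h6

theorem sum_coord_sq : ∑ i, coord i * coord i = 1 := by
  ext x
  have := norm_eq_of_mem_sphere x
  rw [EuclideanSpace.norm_eq, Real.sqrt_eq_one] at this
  simpa [coord, Fin.sum_univ_three, sq] using this

theorem fderiv_norm_apply (x : S2) :
    HasFDerivAt (fun y : E3 => ‖y‖) (innerSL ℝ (x : E3)) (x : E3) := by
  have h := (hasStrictFDerivAt_norm_sq (x : E3)).hasFDerivAt.sqrt (by simp)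
  simp only [norm_nonneg, Real.sqrt_sq] at h
  convert! h using 1
  ext y
  simp [norm_eq_of_mem_sphere x]

theorem D_coord (i j : Fin 3) :
    D i (coord j) = (if i = j then 1 else 0) - coord i * coord j := by
  ext x
  have hx := norm_eq_of_mem_sphere x
  have he : radialExt ⇑(coord j) =ᶠ[nhds (x : E3)] fun y => ‖y‖⁻¹ * y j := by
    filter_upwards [isOpen_ne.mem_nhds (coe_ne_zero x)] with y hy
    simp [coord, radialExt, hy]
  have h1 : HasFDerivAt (fun y : E3 => ‖y‖⁻¹) (-(innerSL ℝ (x : E3))) (x : E3) := by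
    have := (hasDerivAt_inv (by simp [hx] : ‖(x:E3)‖ ≠ 0)).comp_hasFDerivAt (x:E3)
      (fderiv_norm_apply x)
    simpa [hx] using! this
  have h2 : HasFDerivAt (fun y : E3 => y j) (EuclideanSpace.proj j : E3 →L[ℝ] ℝ) (x : E3) :=
    (EuclideanSpace.proj j : E3 →L[ℝ] ℝ).hasFDerivAt
  have h3 := ((h1.mul h2).congr_of_eventuallyEq he).fderiv
  rw [D_apply, h3]
  by_cases hij : i = j
  · subst hij
    simp [ebasis, hx, coord, EuclideanSpace.inner_single_right]; ring
  · simp [ebasis, hx, coord, EuclideanSpace.inner_single_right, hij, Ne.symm hij]; ring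

theorem D_comm (i j : Fin 3) (f : SmoothFn) :
    D i (D j f) - D j (D i f) = coord i * D j f - coord j * D i f := by
  ext x
  have hx := norm_eq_of_mem_sphere x
  have hC := contDiffAt_radialExt f (coe_ne_zero x)
  have hd : DifferentiableAt ℝ (fderiv ℝ (radialExt f)) (x : E3) :=
    (hC.fderiv_right (m := ∞) (by simp)).differentiableAt (by simp)
  have key : ∀ i j : Fin 3, D i (D j f) x = (x : E3) i * D j f x
      + fderiv ℝ (fderiv ℝ (radialExt f)) x (ebasis i) (ebasis j) := by
    intro i j
    have he : radialExt ⇑(D j f) =ᶠ[nhds (x : E3)] fun y => ‖y‖ * fderiv ℝ (radialExt f) y (ebasis j) := by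
      filter_upwards [isOpen_ne.mem_nhds (coe_ne_zero x)] with y hy
      exact radialExt_D j f hy
    have h2 : HasFDerivAt (fun y : E3 => fderiv ℝ (radialExt f) y (ebasis j))
        ((fderiv ℝ (fderiv ℝ (radialExt f)) x).flip (ebasis j)) (x : E3) := by
      simpa using! hd.hasFDerivAt.clm_apply (hasFDerivAt_const (ebasis j) (x : E3))
    have h3 := (((fderiv_norm_apply x).mul h2).congr_of_eventuallyEq he).fderiv
    rw [D_apply, h3, D_apply]
    simp [ebasis, hx, EuclideanSpace.inner_single_right]; ring
  have hs : fderiv ℝ (fderiv ℝ (radialExt f)) x (ebasis i) (ebasis j)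
      = fderiv ℝ (fderiv ℝ (radialExt f)) x (ebasis j) (ebasis i) :=
    (hC.isSymmSndFDerivAt (by simpa using (mod_cast le_top : ((2 : ℕ∞) : WithTop ℕ∞) ≤ ((⊤ : ℕ∞) : WithTop ℕ∞)))).eq _ _
  simp only [ContMDiffMap.coe_sub, ContMDiffMap.coe_mul, Pi.sub_apply, Pi.mul_apply, key, hs]
  simp [coord]

/-- The Riemannian area measure `μ` of the unit sphere. -/
def area : Measure S2 := (volume : Measure E3).toSphere

instance : IsFiniteMeasure area := inferInstanceAs (IsFiniteMeasure (volume : Measure E3).toSphere)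

theorem integrable_area (f : SmoothFn) : Integrable f area :=
  (f.contMDiff.continuous).integrable_of_hasCompactSupport
    (HasCompactSupport.of_compactSpace f)

/-- `f ↦ ∫ f μ` on `C^∞(S²)`. -/
def integ : SmoothFn →ₗ[ℝ] ℝ where
  toFun f := ∫ x, f x ∂area
  map_add' f g := by
    simpa using integral_add (integrable_area f) (integrable_area g)
  map_smul' c f := by
    simpa using integral_const_mul c _

/-- A bump function on the line, supported near `1`. -/
def cut : ContDiffBump (1 : ℝ) := ⟨1/4, 1/2, by norm_num, by norm_num⟩

/-- A smooth radial function with compact support in `ℝ³ ∖ {0}`. -/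
def cutoff (y : E3) : ℝ := cut (‖y‖ ^ 2)

theorem cutoff_contDiff : ContDiff ℝ ∞ cutoff := cut.contDiff.comp (contDiff_norm_sq ℝ)

theorem cutoff_zero_near : ∀ᶠ y in nhds (0 : E3), cutoff y = 0 := by
  have : Filter.Tendsto (fun y : E3 => ‖y‖ ^ 2) (nhds 0) (nhds 0) := by
    have : Continuous (fun y : E3 => ‖y‖ ^ 2) := by fun_prop
    simpa using this.tendsto 0
  filter_upwards [this.eventually (gt_mem_nhds (show (0:ℝ) < 1/2 by norm_num))] with y hy
  apply cut.zero_of_le_dist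
  rw [Real.dist_eq, abs_sub_comm]
  refine le_trans ?_ (le_abs_self _)
  change (1/2 : ℝ) ≤ _
  linarith

theorem cutoff_hcs : HasCompactSupport cutoff := by
  refine HasCompactSupport.intro (isCompact_closedBall (0 : E3) 2) fun y hy => ?_
  apply cut.zero_of_le_dist
  simp only [Metric.mem_closedBall, dist_zero_right, not_le] at hy
  rw [Real.dist_eq]
  refine le_trans ?_ (le_abs_self _)
  change (1/2 : ℝ) ≤ _
  nlinarith

theorem contDiff_cut_mul (g : E3 → ℝ) (hg : ∀ y ≠ 0, ContDiffAt ℝ ∞ g y) :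
    ContDiff ℝ ∞ (fun y => cutoff y * g y) := by
  rw [contDiff_iff_contDiffAt]
  intro y
  by_cases h : y = 0
  · subst h
    refine (contDiffAt_const (c := (0:ℝ))).congr_of_eventuallyEq ?_
    filter_upwards [cutoff_zero_near] with z hz
    simp [hz]
  · exact cutoff_contDiff.contDiffAt.mul (hg y h)

theorem cutoff_polar (f : SmoothFn) :
    ∫ y, cutoff y * radialExt f y
      = integ f * ∫ r : Set.Ioi (0:ℝ), cut ((r : ℝ)^2) ∂(Measure.volumeIoiPow 2) := by
  have h := (volume : Measure E3).measurePreserving_homeomorphUnitSphereProd.integral_comp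
        (Homeomorph.measurableEmbedding _)
        (fun p : S2 × Set.Ioi (0:ℝ) => f p.1 * cut ((p.2 : ℝ)^2))
  have h3 : Module.finrank ℝ E3 - 1 = 2 := by simp
  rw [h3] at h
  calc
    _ = ∫ y : ({(0)}ᶜ : Set E3), cutoff y * radialExt f y ∂((volume : Measure E3).comap (↑)) := by
      rw [integral_subtype_comap (measurableSet_singleton _).compl
        fun y => cutoff y * radialExt f y, restrict_compl_singleton]
    _ = _ := by
      refine Eq.trans ?_ (h.trans (integral_prod_mul (μ := area)
        (ν := Measure.volumeIoiPow 2) (fun x => f x) (fun r : Set.Ioi (0:ℝ) => cut ((r:ℝ)^2))))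
      refine integral_congr_ae (Filter.Eventually.of_forall fun y => ?_)
      have hy : (y : E3) ≠ 0 := y.2
      simp only [radialExt, hy, dif_neg, not_false_eq_true, cutoff]
      rw [mul_comm]
      congr 1
      · congr 1
        ext1
        simp
      · simp

theorem polar_const_ne : ∫ r : Set.Ioi (0:ℝ), cut ((r : ℝ)^2) ∂(Measure.volumeIoiPow 2) ≠ 0 := by
  intro h0
  have h := cutoff_polar 1
  rw [h0, mul_zero] at h
  have hs : (fun y => cutoff y * radialExt ⇑(1 : SmoothFn) y) = cutoff := by
    funext y
    by_cases hy : y = 0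
    · subst hy; simp [cutoff_zero_near.self_of_nhds]
    · simp [radialExt, hy]
  rw [hs] at h
  have hpos : 0 < ∫ y, cutoff y := by
    refine cutoff_contDiff.continuous.integral_pos_of_hasCompactSupport_nonneg_nonzero
      cutoff_hcs (fun y => cut.nonneg) (x := ebasis 0) ?_
    have : cutoff (ebasis 0) = 1 := by
      simp only [cutoff, ebasis, PiLp.norm_single, norm_one, one_pow]
      exact cut.one_of_mem_closedBall (by simp [cut])
    rw [this]; exact one_ne_zero
  linarith

theorem integral_coord_mul_fderiv (F : E3 → ℝ) (hF : ContDiff ℝ ∞ F) (hc : HasCompactSupport F)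
    (a b : Fin 3) (hab : a ≠ b) : ∫ y : E3, y a * fderiv ℝ F y (ebasis b) = 0 := by
  have hp : ∀ y : E3, HasFDerivAt (fun y : E3 => y a) (EuclideanSpace.proj a : E3 →L[ℝ] ℝ) y :=
    fun y => (EuclideanSpace.proj a : E3 →L[ℝ] ℝ).hasFDerivAt
  have hz : ∀ y : E3, fderiv ℝ (fun y : E3 => y a) y (ebasis b) = 0 := by
    intro y
    rw [(hp y).fderiv]
    simp [ebasis, hab]
  have hca : Continuous fun y : E3 => y a := by fun_prop
  have h := integral_mul_fderiv_eq_neg_fderiv_mul_of_integrable (μ := (volume : Measure E3))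
    (f := fun y : E3 => y a) (g := F) (v := ebasis b) (by simp [hz])
    ((hca.mul ((hF.continuous_fderiv (by simp)).clm_apply continuous_const)).integrable_of_hasCompactSupport
      ((hc.fderiv_apply (𝕜 := ℝ) (ebasis b)).mul_left))
    ((hca.mul hF.continuous).integrable_of_hasCompactSupport hc.mul_left)
    (fun y _ => (hp y).differentiableAt)
    (fun y _ => hF.differentiable (by simp) y)
  simpa [hz] using h

theorem integrable_coord_mul_fderiv (F : E3 → ℝ) (hF : ContDiff ℝ ∞ F) (hc : HasCompactSupport F)
    (a b : Fin 3) : Integrable (fun y : E3 => y a * fderiv ℝ F y (ebasis b)) := by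
  have hca : Continuous fun y : E3 => y a := by fun_prop
  exact ((hca.mul ((hF.continuous_fderiv (by simp)).clm_apply continuous_const)).integrable_of_hasCompactSupport
      ((hc.fderiv_apply (𝕜 := ℝ) (ebasis b)).mul_left))

theorem integ_rot (f : SmoothFn) (a b : Fin 3) (hab : a ≠ b) :
    integ (coord a * D b f - coord b * D a f) = 0 := by
  set F : E3 → ℝ := fun y => cutoff y * radialExt f y with hFdef
  have hF : ContDiff ℝ ∞ F := contDiff_cut_mul _ fun y hy => contDiffAt_radialExt f hy
  have hc : HasCompactSupport F := cutoff_hcs.mul_right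
  have h1 : ∫ y : E3, (y a * fderiv ℝ F y (ebasis b) - y b * fderiv ℝ F y (ebasis a)) = 0 := by
    rw [integral_sub (integrable_coord_mul_fderiv F hF hc a b)
      (integrable_coord_mul_fderiv F hF hc b a), integral_coord_mul_fderiv F hF hc a b hab,
      integral_coord_mul_fderiv F hF hc b a hab.symm, sub_zero]
  have h2 : (fun y : E3 => y a * fderiv ℝ F y (ebasis b) - y b * fderiv ℝ F y (ebasis a))
      = fun y => cutoff y * radialExt ⇑(coord a * D b f - coord b * D a f) y := by
    funext y
    by_cases hy : y = 0
    · subst hy; simp [cutoff_zero_near.self_of_nhds]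
    · have hd : DifferentiableAt ℝ (radialExt f) y :=
        (contDiffAt_radialExt f hy).differentiableAt (by simp)
      have hcd : HasFDerivAt cutoff ((deriv cut (‖y‖^2)) • (2 • (innerSL ℝ y))) y := by
        have hd1 : DifferentiableAt ℝ cut (‖y‖^2) :=
          (cut.contDiff (n := (⊤ : ℕ∞))).differentiable (by simp) _
        exact hd1.hasDerivAt.comp_hasFDerivAt y (hasStrictFDerivAt_norm_sq y).hasFDerivAt
      have h3 : ∀ i, fderiv ℝ F y (ebasis i) = cutoff y * fderiv ℝ (radialExt f) y (ebasis i)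
          + radialExt f y * (deriv cut (‖y‖^2) * (2 * y i)) := by
        intro i
        have h5 : HasFDerivAt F _ y := hcd.mul hd.hasFDerivAt
        rw [h5.fderiv]
        simp [ebasis, EuclideanSpace.inner_single_right]
      have h4 : radialExt ⇑(coord a * D b f - coord b * D a f) y
          = y a * fderiv ℝ (radialExt f) y (ebasis b) - y b * fderiv ℝ (radialExt f) y (ebasis a) := by
        have hn : ‖y‖ ≠ 0 := norm_ne_zero_iff.2 hy
        have ha := radialExt_D a f hy
        have hb := radialExt_D b f hy
        simp only [radialExt, hy, dif_neg, not_false_eq_true] at ha hb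
        simp only [radialExt, hy, dif_neg, not_false_eq_true, ContMDiffMap.coe_sub,
          ContMDiffMap.coe_mul, Pi.sub_apply, Pi.mul_apply, ha, hb]
        simp [coord]
        field_simp
      rw [h3, h3, h4]
      ring
  rw [h2, cutoff_polar] at h1
  exact (mul_eq_zero.1 h1).resolve_right polar_const_ne

/-- The Riemannian gradient on `S²`, as a vector in `ℝ³` with smooth components. -/
def grad (f : SmoothFn) : Fin 3 → SmoothFn := fun i => D i f

/-- The Poisson bracket `{f, h} μ = df ∧ dh` on `S²`, i.e. `{f, h}(x) = x · (∇f(x) × ∇h(x))`. -/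
def poisson (f h : SmoothFn) : SmoothFn := coord ⬝ᵥ (crossProduct (grad f) (grad h))

/-- The Laplace–Beltrami operator on `S²`. -/
def lap (f : SmoothFn) : SmoothFn := ∑ i, D i (D i f)

/-- The vector field `x × ∇ψ`, as a derivation; it is `f ↦ {ψ, f}` by `hamDer_apply`. -/
def hamDer (ψ : SmoothFn) : Derivation ℝ SmoothFn SmoothFn :=
  ∑ i, crossProduct coord (grad ψ) i • D i

theorem hamDer_apply (ψ f : SmoothFn) : hamDer ψ f = poisson ψ f := by
  simp only [hamDer, poisson, Fin.sum_univ_three, Derivation.coe_add, Pi.add_apply,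
    Derivation.coe_smul, Pi.smul_apply, smul_eq_mul, crossProduct, LinearMap.mk₂_apply,
    Matrix.vec3_dotProduct, grad, Matrix.cons_val_zero, Matrix.cons_val_one, Matrix.cons_val]
  ring

/-- The components `v(xᵢ)` of a vector field `v` on `S²`, seen as a tangent vector in `ℝ³`. -/
def comp (v : Derivation ℝ SmoothFn SmoothFn) (i : Fin 3) : SmoothFn := v (coord i)

theorem sum_coord_comp (v : Derivation ℝ SmoothFn SmoothFn) : ∑ i, coord i * comp v i = 0 := by
  have h := congrArg v sum_coord_sq
  simp only [Fin.sum_univ_three, map_add, Derivation.leibniz, smul_eq_mul,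
    Derivation.map_one_eq_zero] at h
  have h2 : (2:ℝ) • ∑ i, coord i * comp v i = 0 := by
    rw [← h]; simp only [comp, Fin.sum_univ_three, two_smul]; ring
  exact (smul_eq_zero.1 h2).resolve_left two_ne_zero

theorem comp_lie (v w : Derivation ℝ SmoothFn SmoothFn) (i : Fin 3) :
    comp ⁅v, w⁆ i = v (comp w i) - w (comp v i) := by
  simp [comp, Derivation.commutator_apply]

/-- `v` acts on functions as the directional derivative along the smooth tangent vector field with
components `v(xᵢ)`. -/
def IsVectorField (v : Derivation ℝ SmoothFn SmoothFn) : Prop :=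
  ∀ f, v f = ∑ i, comp v i * D i f

theorem IsVectorField.lie {v w : Derivation ℝ SmoothFn SmoothFn} (hv : IsVectorField v)
    (hw : IsVectorField w) : IsVectorField ⁅v, w⁆ := by
  intro f
  have e := fun i j => D_comm i j f
  have hV := sum_coord_comp v
  have hW := sum_coord_comp w
  simp only [Fin.sum_univ_three] at hV hW
  have hvi : ∀ i, v (D i f) = ∑ j, comp v j * D j (D i f) := fun i => hv (D i f)
  have hwi : ∀ i, w (D i f) = ∑ j, comp w j * D j (D i f) := fun i => hw (D i f)
  rw [Derivation.commutator_apply, hw f, hv f]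
  simp only [Fin.sum_univ_three, map_add, Derivation.leibniz, smul_eq_mul, hvi, hwi, comp_lie]
  have e01 := e 0 1
  have e02 := e 0 2
  have e12 := e 1 2
  generalize comp v 0 = V0 at *
  generalize comp v 1 = V1 at *
  generalize comp v 2 = V2 at *
  generalize comp w 0 = W0 at *
  generalize comp w 1 = W1 at *
  generalize comp w 2 = W2 at *
  linear_combination (V0 * W1 - V1 * W0) * e01 + (V0 * W2 - V2 * W0) * e02
    + (V1 * W2 - V2 * W1) * e12 + (W0 * D 0 f + W1 * D 1 f + W2 * D 2 f) * hV
    - (V0 * D 0 f + V1 * D 1 f + V2 * D 2 f) * hW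

theorem integ_poisson (ψ f : SmoothFn) : integ (poisson ψ f) = 0 := by
  have h : poisson ψ f =
      (coord 2 * D 0 (f * D 1 ψ) - coord 0 * D 2 (f * D 1 ψ)) * (-1)
      + (coord 1 * D 2 (f * D 0 ψ) - coord 2 * D 1 (f * D 0 ψ)) * (-1)
      + (coord 0 * D 1 (f * D 2 ψ) - coord 1 * D 0 (f * D 2 ψ)) * (-1) := by
    have e01 := D_comm 0 1 ψ
    have e02 := D_comm 0 2 ψ
    have e12 := D_comm 1 2 ψ
    simp only [poisson, crossProduct, LinearMap.mk₂_apply,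
      Matrix.vec3_dotProduct, grad, Matrix.cons_val_zero, Matrix.cons_val_one, Matrix.cons_val,
      Derivation.leibniz, smul_eq_mul]
    linear_combination f * (coord 2 * e01 - coord 1 * e02 + coord 0 * e12)
  rw [h]
  simp only [mul_neg_one, map_add, map_neg, integ_rot _ _ _ (show (2 : Fin 3) ≠ 0 by decide),
    integ_rot _ _ _ (show (1 : Fin 3) ≠ 2 by decide),
    integ_rot _ _ _ (show (0 : Fin 3) ≠ 1 by decide), neg_zero, add_zero]

/-- The Lie algebra `X_μ(S²)` of smooth area-preserving (divergence-free) vector fields on `S²`, with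
the commutator of vector fields: `∫ v(f) μ = 0` for all smooth `f` says that `v` has divergence `0`. -/
def divFree : LieSubalgebra ℝ (Derivation ℝ SmoothFn SmoothFn) where
  carrier := {v | IsVectorField v ∧ ∀ f, integ (v f) = 0}
  add_mem' := by
    rintro v w ⟨hv, hv'⟩ ⟨hw, hw'⟩
    refine ⟨fun f => ?_, fun f => by simp [hv', hw']⟩
    simp [comp, add_mul, Finset.sum_add_distrib, hv f, hw f]
  zero_mem' := ⟨fun f => by simp [comp], fun f => by simp⟩
  smul_mem' := by
    rintro c v ⟨hv, hv'⟩
    refine ⟨fun f => ?_, fun f => by simp [hv']⟩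
    simp [comp, hv f, Finset.smul_sum]
  lie_mem' := by
    rintro v w ⟨hv, hv'⟩ ⟨hw, hw'⟩
    refine ⟨hv.lie hw, fun f => ?_⟩
    simp [Derivation.commutator_apply, hv', hw']

theorem comp_hamDer (ψ : SmoothFn) (i : Fin 3) :
    comp (hamDer ψ) i = (crossProduct coord (grad ψ)) i := by
  simp only [comp, hamDer_apply, poisson, Matrix.vec3_dotProduct, crossProduct,
    LinearMap.mk₂_apply, grad, D_coord]
  fin_cases i <;> simp <;> ring

theorem hamDer_isVectorField (ψ : SmoothFn) : IsVectorField (hamDer ψ) := by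
  intro f
  simp only [comp_hamDer]
  simp [hamDer, Fin.sum_univ_three]

/-- The Hamiltonian vector field `X_ψ = {ψ, ·}` with stream function `ψ`, as an element of `X_μ(S²)`. -/
def ham (ψ : SmoothFn) : divFree :=
  ⟨hamDer ψ, hamDer_isVectorField ψ, fun f => by rw [hamDer_apply, integ_poisson]⟩

theorem ham_lie (ψ σ : SmoothFn) : ⁅ham ψ, σ⁆ = poisson ψ σ := hamDer_apply ψ σ

/-- The area form `μ(v, w)`, i.e. `x · (v(x) × w(x))`. -/
def areaForm (v w : divFree) : SmoothFn := coord ⬝ᵥ (crossProduct (comp v) (comp w))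

theorem areaForm_ham (ψ φ : SmoothFn) : areaForm (ham ψ) (ham φ) = poisson ψ φ := by
  have hx := sum_coord_sq
  simp only [Fin.sum_univ_three] at hx
  simp only [areaForm, ham, poisson, Matrix.vec3_dotProduct, crossProduct, LinearMap.mk₂_apply,
    comp_hamDer, Matrix.cons_val_zero, Matrix.cons_val_one, Matrix.cons_val]
  generalize coord 0 = x0 at *
  generalize coord 1 = x1 at *
  generalize coord 2 = x2 at *
  linear_combination (x0 * (grad ψ 1 * grad φ 2 - grad ψ 2 * grad φ 1)
    + x1 * (grad ψ 2 * grad φ 0 - grad ψ 0 * grad φ 2)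
    + x2 * (grad ψ 0 * grad φ 1 - grad ψ 1 * grad φ 0)) * hx

open LieModule.Cohomology

theorem triple_zero (u v w : Derivation ℝ SmoothFn SmoothFn) :
    comp u ⬝ᵥ (crossProduct (comp v) (comp w)) = 0 := by
  have hx := sum_coord_sq
  have hu := sum_coord_comp u
  have hv := sum_coord_comp v
  have hw := sum_coord_comp w
  simp only [Fin.sum_univ_three] at hx hu hv hw
  simp only [Matrix.vec3_dotProduct, crossProduct, LinearMap.mk₂_apply,
    Matrix.cons_val_zero, Matrix.cons_val_one, Matrix.cons_val]
  generalize coord 0 = x0 at *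
  generalize coord 1 = x1 at *
  generalize coord 2 = x2 at *
  generalize comp u 0 = u0 at *
  generalize comp u 1 = u1 at *
  generalize comp u 2 = u2 at *
  generalize comp v 0 = v0 at *
  generalize comp v 1 = v1 at *
  generalize comp v 2 = v2 at *
  generalize comp w 0 = w0 at *
  generalize comp w 1 = w1 at *
  generalize comp w 2 = w2 at *
  have c0 : x0 * (u0 * (v1 * w2 - v2 * w1) + u1 * (v2 * w0 - v0 * w2) + u2 * (v0 * w1 - v1 * w0)) = 0 := by
    linear_combination (v1 * w2 - v2 * w1) * hu + (w1 * u2 - w2 * u1) * hv + (u1 * v2 - u2 * v1) * hw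
  have c1 : x1 * (u0 * (v1 * w2 - v2 * w1) + u1 * (v2 * w0 - v0 * w2) + u2 * (v0 * w1 - v1 * w0)) = 0 := by
    linear_combination (v2 * w0 - v0 * w2) * hu + (w2 * u0 - w0 * u2) * hv + (u2 * v0 - u0 * v2) * hw
  have c2 : x2 * (u0 * (v1 * w2 - v2 * w1) + u1 * (v2 * w0 - v0 * w2) + u2 * (v0 * w1 - v1 * w0)) = 0 := by
    linear_combination (v0 * w1 - v1 * w0) * hu + (w0 * u1 - w1 * u0) * hv + (u0 * v1 - u1 * v0) * hw
  linear_combination x0 * c0 + x1 * c1 + x2 * c2 - (u0 * (v1 * w2 - v2 * w1) + u1 * (v2 * w0 - v0 * w2) + u2 * (v0 * w1 - v1 * w0)) * hx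

theorem areaForm_eq (v w : divFree) : areaForm v w =
    coord 0 * (comp v 1 * comp w 2 - comp v 2 * comp w 1)
    + coord 1 * (comp v 2 * comp w 0 - comp v 0 * comp w 2)
    + coord 2 * (comp v 0 * comp w 1 - comp v 1 * comp w 0) := by
  simp only [areaForm, Matrix.vec3_dotProduct, crossProduct, LinearMap.mk₂_apply,
    Matrix.cons_val_zero, Matrix.cons_val_one, Matrix.cons_val]

theorem comp_add (v w : divFree) (i : Fin 3) : comp ↑(v + w) i = comp v i + comp w i := rfl

theorem comp_smul (c : ℝ) (v : divFree) (i : Fin 3) : comp ↑(c • v) i = c • comp v i := rfl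

/-- `b(v, w) = -μ(v, w)`, i.e. `b(X_ψ, X_φ) = -{ψ, φ}` by `areaForm_ham`. -/
def cochain : twoCochain ℝ divFree SmoothFn :=
  ⟨LinearMap.mk₂ ℝ (fun v w => -areaForm v w)
      (fun u v w => by simp only [areaForm_eq, comp_add]; ring)
      (fun c u v => by
        simp only [areaForm_eq, comp_smul, Algebra.smul_def]; ring)
      (fun u v w => by simp only [areaForm_eq, comp_add]; ring)
      (fun c u v => by
        simp only [areaForm_eq, comp_smul, Algebra.smul_def]; ring),
    fun v => by simp only [LinearMap.mk₂_apply, areaForm_eq]; ring⟩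

theorem cochain_apply (v w : divFree) : cochain v w = -areaForm v w := rfl

theorem cochain_mem : cochain ∈ twoCocycle ℝ divFree SmoothFn := by
  rw [mem_twoCocycle_iff]
  refine LinearMap.ext fun u => LinearMap.ext fun v => LinearMap.ext fun w => ?_
  have h := triple_zero u v w
  simp only [Matrix.vec3_dotProduct, crossProduct, LinearMap.mk₂_apply,
    Matrix.cons_val_zero, Matrix.cons_val_one, Matrix.cons_val] at h
  have hl : ∀ (a : divFree) (f : SmoothFn), ⁅a, f⁆ = (a : Derivation ℝ SmoothFn SmoothFn) f :=
    fun a f => rfl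
  have hc : ∀ (a : Derivation ℝ SmoothFn SmoothFn) i, a (coord i) = comp a i := fun _ _ => rfl
  simp only [d₂₃_apply, cochain_apply, areaForm_eq, LinearMap.zero_apply, hl,
    LieSubalgebra.coe_bracket, comp_lie, map_neg, map_add, map_sub, Derivation.leibniz,
    smul_eq_mul, hc]
  linear_combination (-3) * h

/-- The cocycle `b`. -/
def cocycle : twoCocycle ℝ divFree SmoothFn := ⟨cochain, cochain_mem⟩

/-- The Abelian extension `f = X_μ(S²) × C^∞(S²)` of `X_μ(S²)` by its module `C^∞(S²)`, on which `v`
acts by `σ ↦ v(σ)`, with the cocycle `b`: the bracket is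
`[(v, σ), (w, τ)] = ([v, w], v(τ) - w(σ) + b(v, w))`, see `AbelianExt.lie_eq`. -/
abbrev AbelianExt : Type := LieAlgebra.ofTwoCocycle cocycle

namespace AbelianExt

def mk (v : divFree) (σ : SmoothFn) : AbelianExt := LieAlgebra.ofProd cocycle (v, σ)

def vf (x : AbelianExt) : divFree := x.carrier.1

def fn (x : AbelianExt) : SmoothFn := x.carrier.2

@[simp] theorem vf_mk (v : divFree) (σ : SmoothFn) : (mk v σ).vf = v := rfl
@[simp] theorem fn_mk (v : divFree) (σ : SmoothFn) : (mk v σ).fn = σ := rfl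
@[simp] theorem vf_add (x y : AbelianExt) : (x + y).vf = x.vf + y.vf := rfl
@[simp] theorem fn_add (x y : AbelianExt) : (x + y).fn = x.fn + y.fn := rfl
@[simp] theorem vf_smul (c : ℝ) (x : AbelianExt) : (c • x).vf = c • x.vf := rfl
@[simp] theorem fn_smul (c : ℝ) (x : AbelianExt) : (c • x).fn = c • x.fn := rfl

theorem lie_eq (x y : AbelianExt) :
    ⁅x, y⁆ = mk ⁅x.vf, y.vf⁆ (⁅x.vf, y.fn⁆ - ⁅y.vf, x.fn⁆ - areaForm x.vf y.vf) := by
  have h : -areaForm x.vf y.vf + ⁅x.vf, y.fn⁆ - ⁅y.vf, x.fn⁆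
      = ⁅x.vf, y.fn⁆ - ⁅y.vf, x.fn⁆ - areaForm x.vf y.vf := by abel
  rw [← h]
  rfl

end AbelianExt

/-- `⟨(v, σ), (w, τ)⟩ = ∫ (κ σ τ + g(v, w)) μ` on `f`, where `g` is the round metric. As a map from
`f` to its algebraic dual it is an inertia operator. -/
def inertia (κ : ℝ) : AbelianExt →ₗ[ℝ] Module.Dual ℝ AbelianExt :=
  LinearMap.mk₂ ℝ
    (fun x y => integ (κ • (x.fn * y.fn) + ∑ i, comp x.vf i * comp y.vf i))
    (fun x y z => by
      rw [← map_add]; congr 1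
      simp only [AbelianExt.fn_add, AbelianExt.vf_add, comp_add, Fin.sum_univ_three,
        Algebra.smul_def]
      ring)
    (fun c x y => by
      rw [← map_smul]; congr 1
      simp only [AbelianExt.fn_smul, AbelianExt.vf_smul, comp_smul, Fin.sum_univ_three,
        Algebra.smul_def]
      ring)
    (fun x y z => by
      rw [← map_add]; congr 1
      simp only [AbelianExt.fn_add, AbelianExt.vf_add, comp_add, Fin.sum_univ_three,
        Algebra.smul_def]
      ring)
    (fun c x y => by
      rw [← map_smul]; congr 1
      simp only [AbelianExt.fn_smul, AbelianExt.vf_smul, comp_smul, Fin.sum_univ_three,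
        Algebra.smul_def]
      ring)

theorem integ_lie (v : divFree) (f : SmoothFn) : integ ((v : Derivation ℝ SmoothFn SmoothFn) f) = 0 :=
  v.2.2 f

/-- The smooth dual `f*`: functionals `(v, σ) ↦ ∫ (r σ + θ(v)) μ` with a smooth function `r` and a
smooth 1-form `θ = ∑ aᵢ dxᵢ`. It is a submodule of the coadjoint module, on which `x` acts by
`(x • l)(y) = -l([x, y])`, i.e. by `-ad*_x`. -/
def smoothDual : LieSubmodule ℝ AbelianExt (Module.Dual ℝ AbelianExt) where
  carrier := {l | ∃ (r : SmoothFn) (a : Fin 3 → SmoothFn), ∀ x : AbelianExt,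
    l x = integ (r * x.fn + ∑ i, a i * comp x.vf i)}
  add_mem' := by
    rintro l m ⟨r, a, h⟩ ⟨r', a', h'⟩
    refine ⟨r + r', a + a', fun x => ?_⟩
    rw [LinearMap.add_apply, h, h', ← map_add]
    congr 1
    simp only [Fin.sum_univ_three, Pi.add_apply]
    ring
  zero_mem' := ⟨0, 0, fun x => by simp⟩
  smul_mem' := by
    rintro c l ⟨r, a, h⟩
    refine ⟨c • r, c • a, fun x => ?_⟩
    rw [LinearMap.smul_apply, h, ← map_smul]
    congr 1
    simp only [Fin.sum_univ_three, Pi.smul_apply, Algebra.smul_def]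
    ring
  lie_mem := by
    rintro x l ⟨r, a, h⟩
    refine ⟨⁅x.vf, r⁆, fun j => r * crossProduct coord (comp x.vf) j + r * D j x.fn
      + ⁅x.vf, a j⁆ + ∑ i, a i * D j (comp x.vf i), fun y => ?_⟩
    rw [Module.Dual.lie_apply, h, AbelianExt.lie_eq, neg_eq_iff_add_eq_zero, ← map_add]
    have hl : ∀ (v : divFree) (f : SmoothFn), ⁅v, f⁆ = (v : Derivation ℝ SmoothFn SmoothFn) f :=
      fun v f => rfl
    have hd := y.vf.2.1
    refine Eq.trans ?_ (integ_lie x.vf (r * y.fn + ∑ i, a i * comp y.vf i))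
    congr 1
    simp only [AbelianExt.fn_mk, AbelianExt.vf_mk, hl, hd x.fn, areaForm_eq, Fin.sum_univ_three,
      LieSubalgebra.coe_bracket, comp_lie, hd (comp _ _), map_add, Derivation.leibniz, smul_eq_mul,
      crossProduct, LinearMap.mk₂_apply, Matrix.cons_val_zero, Matrix.cons_val_one, Matrix.cons_val]
    ring

theorem inertia_mem (κ : ℝ) (x : AbelianExt) : inertia κ x ∈ smoothDual :=
  ⟨κ • x.fn, comp x.vf, fun y => by simp [inertia]⟩

/-- The inertia operator `f → f*`. -/
def inertiaOp (κ : ℝ) (x : AbelianExt) : smoothDual := ⟨inertia κ x, inertia_mem κ x⟩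

/-- The magnetic extension `F = f ⋉ f*`, the semidirect product of `f` and the coadjoint module (the
extension with zero cocycle): `[(v, a), (w, c)] = ([v, w], ad*_w a - ad*_v c)`, see
`MagneticExt.lie_eq`. -/
abbrev MagneticExt : Type := LieAlgebra.ofTwoCocycle (0 : twoCocycle ℝ AbelianExt smoothDual)

namespace MagneticExt

def mk (v : AbelianExt) (a : smoothDual) : MagneticExt := LieAlgebra.ofProd 0 (v, a)

def fst (y : MagneticExt) : AbelianExt := y.carrier.1

def snd (y : MagneticExt) : smoothDual := y.carrier.2

theorem lie_eq (x y : MagneticExt) :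
    ⁅x, y⁆ = mk ⁅x.fst, y.fst⁆ (⁅x.fst, y.snd⁆ - ⁅y.fst, x.snd⁆) := by
  refine (LieAlgebra.bracket_ofTwoCocycle x y).trans ?_
  refine congrArg (fun z => LieAlgebra.ofProd _ (⁅x.fst, y.fst⁆, z - ⁅y.fst, x.snd⁆)) ?_
  exact zero_add (⁅x.fst, y.snd⁆ : smoothDual)

end MagneticExt

/-- The dual `F* = f × f*` of `F = f ⋉ f*`; its elements are written `(w, b)`. -/
abbrev MagneticDual : Type := AbelianExt × smoothDual

/-- The duality between `F*` and `F`: `⟨(w, b), (v, a)⟩ = b(v) + a(w)`. -/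
def pairing (m : MagneticDual) (y : MagneticExt) : ℝ :=
  (m.2 : Module.Dual ℝ AbelianExt) y.fst + (y.snd : Module.Dual ℝ AbelianExt) m.1

/-- `∂ₜ m = ad*_x m` on the time set `J`, where `⟨ad*_x m, y⟩ = ⟨m, [x, y]⟩` for all `y` in `F`. -/
def IsEulerArnoldCurve (J : Set ℝ) (m : ℝ → MagneticDual) (x : ℝ → MagneticExt) : Prop :=
  ∀ t ∈ J, ∀ y : MagneticExt,
    HasDerivAt (fun s => pairing (m s) y) (pairing (m t) ⁅x t, y⁆) t

/-- `x`, an element of `F`, is the differential of `h : F* → ℝ` at the point `m`. -/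
def IsDifferentialAt (h : MagneticDual → ℝ) (m : MagneticDual) (x : MagneticExt) : Prop :=
  ∀ δ : MagneticDual, HasDerivAt (fun s : ℝ => h (m + s • δ)) (pairing δ x) 0

/-- `m` is a trajectory, on the time set `J`, of the Lie–Poisson system on `F*` with Hamiltonian
`h`: `∂ₜ m = ad*_{dh(m)} m`. -/
def IsLiePoissonCurve (h : MagneticDual → ℝ) (J : Set ℝ) (m : ℝ → MagneticDual) : Prop :=
  ∃ x : ℝ → MagneticExt, (∀ t ∈ J, IsDifferentialAt h (m t) (x t)) ∧ IsEulerArnoldCurve J m x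

/-- The Hamiltonian `h(w, b) = ½ ⟨I w, w⟩ + ½ ⟨b, I⁻¹ b⟩` on `F*`, with the inertia operator
`I = inertia 4`, i.e. with the inner product `∫ (4 σ σ' + g(v, v')) μ` on `f`. The second summand
is written as the Legendre transform of `v ↦ ½ ⟨I v, v⟩`, which avoids inverting `I`. -/
def hamiltonian (m : MagneticDual) : ℝ :=
  1 / 2 * inertia 4 m.1 m.1
    + ⨆ v : AbelianExt, ((m.2 : Module.Dual ℝ AbelianExt) v - 1 / 2 * inertia 4 v v)

/-- The point `(B, I u)` of `F*`, where `u = (X_ψ, q/2)`, `B = (X_ξ, ρ/2)` and `I = inertia 4`,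
so that `I u` is the functional `(v, σ) ↦ ∫ (2 q σ + g(X_ψ, v)) μ`. -/
def momentum (ψ ρ q ξ : SmoothFn) : MagneticDual :=
  (AbelianExt.mk (ham ξ) ((1 / 2 : ℝ) • ρ),
    inertiaOp 4 (AbelianExt.mk (ham ψ) ((1 / 2 : ℝ) • q)))

/-- The point `((ρ, ξ), (q, ψ))` of `F*`, where `(q, ψ)` is identified with an element of `f*`
by the pairing `∫ (q α + g(X_ψ, X_β)) μ = ∫ (q α - ψ Δβ) μ`. -/
def coalgebraFields (ψ ρ q ξ : SmoothFn) : MagneticDual :=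
  (AbelianExt.mk (ham ξ) ρ, inertiaOp 1 (AbelianExt.mk (ham ψ) q))

/-- The element `((α, β), (γ, δ))` of `F`, where `(γ, δ)` is identified with an element of `f*`
by the same pairing. -/
def algebraFields (α β γ δ : SmoothFn) : MagneticExt :=
  MagneticExt.mk (AbelianExt.mk (ham β) α) (inertiaOp 1 (AbelianExt.mk (ham δ) γ))

/-- The energy `-½ ∫ (ψ Δψ - q²) μ - ½ ∫ (ξ Δξ - ρ²) μ`. -/
def energy (ψ ρ q ξ : SmoothFn) : ℝ :=
  -(1 / 2) * integ (ψ * lap ψ - q ^ 2) - 1 / 2 * integ (ξ * lap ξ - ρ ^ 2)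

/-- `(t, x) ↦ u t x` is smooth on `J × S²`. -/
def SmoothInTime (J : Set ℝ) (u : ℝ → SmoothFn) : Prop :=
  ContMDiffOn (𝓘(ℝ, ℝ).prod (𝓡 2)) 𝓘(ℝ, ℝ) ∞ (fun p : ℝ × S2 => u p.1 p.2) (J ×ˢ Set.univ)

/-- The system of axisymmetric MHD equations, holding at all times in `J` and all points of `S²`:
`∂ₜ Δψ = {Δψ, ψ} + {ξ, Δξ} + 2 {q, ψ} + 2 {ξ, ρ}`, `∂ₜ ρ = {ρ, ψ} + {ξ, q} + 2 {ψ, ξ}`,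
`∂ₜ q = {q, ψ} + {ξ, ρ}`, `∂ₜ ξ = {ξ, ψ}`. -/
def SolvesAxisymmetricMHD (J : Set ℝ) (ψ ρ q ξ : ℝ → SmoothFn) : Prop :=
  ∀ t ∈ J, ∀ x : S2,
    HasDerivAt (fun s => lap (ψ s) x)
      ((poisson (lap (ψ t)) (ψ t) + poisson (ξ t) (lap (ξ t))
        + 2 * poisson (q t) (ψ t) + 2 * poisson (ξ t) (ρ t)) x) t ∧
    HasDerivAt (fun s => ρ s x)
      ((poisson (ρ t) (ψ t) + poisson (ξ t) (q t) + 2 * poisson (ψ t) (ξ t)) x) t ∧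
    HasDerivAt (fun s => q s x) ((poisson (q t) (ψ t) + poisson (ξ t) (ρ t)) x) t ∧
    HasDerivAt (fun s => ξ s x) (poisson (ξ t) (ψ t) x) t

end

end AxiMHD

/-!
On `S²` a closed 1-form is exact: pulled back along `x ↦ x / |x|` it becomes a closed form on
`ℝ³ ∖ 0`, which has a primitive. Hence every divergence-free field has a stream function, and an
element of `F` acts on a point of `F*` only through four smooth functions. Testing the Euler–Arnold
equation against these and integrating by parts gives the weak form of equations for `Δψ, ρ, q` and
for `ξ` up to an additive constant; the constant is fixed by `∫ ξ μ`, because the constants are the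
kernel of `Δ`.

The second term of the Hamiltonian is the Legendre transform of `½ I₄`, which along any line through
`I₄ u` is a quadratic polynomial with linear coefficient `u`. Therefore `dh(w, I₄ u) = (u, I₄ w)`,
and the Lie–Poisson equation is an Euler–Arnold equation. The two parts of the theorem are the same
statement about `I_κ`, with `κ = 4` and halved `ρ, q` in the first, `κ = 1` in the second.
-/

namespace AxiMHD

open scoped Matrix

section Integration

theorem coord_dotProduct_coord : coord ⬝ᵥ coord = 1 := sum_coord_sq

theorem coord_dotProduct_grad (f : SmoothFn) : coord ⬝ᵥ grad f = 0 := sum_coord_mul_D f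

theorem coord_dotProduct_comp (v : Derivation ℝ SmoothFn SmoothFn) : coord ⬝ᵥ comp v = 0 :=
  sum_coord_comp v

theorem sum_D_coord_mul (f : SmoothFn) : ∑ j, D j (coord j * f) = 2 * f := by
  have hdiv : ∑ j, D j (coord j) = 2 := by
    simp only [D_coord, ↓reduceIte, Finset.sum_sub_distrib, sum_coord_sq]
    norm_num
  simp only [Derivation.leibniz, smul_eq_mul, Finset.sum_add_distrib, ← Finset.mul_sum,
    sum_coord_mul_D, hdiv]
  ring

theorem sum_coord_mul_D_coord_mul (i : Fin 3) (f : SmoothFn) :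
    ∑ j, coord j * D i (coord j * f) = D i f := by
  have hsq : ∑ j, coord j * D i (coord j) = 0 := by
    simp only [D_coord, mul_sub, mul_ite, mul_one, mul_zero, Finset.sum_sub_distrib,
      Finset.sum_ite_eq, Finset.mem_univ, ↓reduceIte, mul_left_comm _ (coord i),
      ← Finset.mul_sum, sum_coord_sq, sub_self]
  calc ∑ j, coord j * D i (coord j * f)
      = (∑ j, coord j * coord j) * D i f + f * ∑ j, coord j * D i (coord j) := by
        simp only [Finset.sum_mul, Finset.mul_sum, ← Finset.sum_add_distrib, Derivation.leibniz,
          smul_eq_mul]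
        exact Finset.sum_congr rfl fun j _ => by ring
    _ = D i f := by rw [sum_coord_sq, hsq, one_mul, mul_zero, add_zero]

theorem integ_coord_mul_D_comm (i j : Fin 3) (f : SmoothFn) :
    integ (coord i * D j f) = integ (coord j * D i f) := by
  obtain rfl | hij := eq_or_ne i j
  · rfl
  · rw [← sub_eq_zero, ← map_sub, integ_rot f i j hij]

/-- The factor `2` is the trace of the second fundamental form of `S²`. -/
theorem integ_D (i : Fin 3) (f : SmoothFn) : integ (D i f) = integ (2 * coord i * f) :=
  calc integ (D i f) = ∑ j, integ (coord j * D i (coord j * f)) := by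
        rw [← map_sum, sum_coord_mul_D_coord_mul]
    _ = ∑ j, integ (coord i * D j (coord j * f)) :=
        Finset.sum_congr rfl fun j _ => integ_coord_mul_D_comm j i _
    _ = integ (2 * coord i * f) := by
        rw [← map_sum, ← Finset.mul_sum, sum_D_coord_mul, mul_left_comm, mul_assoc]

theorem integ_mul_D (i : Fin 3) (f g : SmoothFn) :
    integ (f * D i g) = integ (g * (2 * coord i * f - D i f)) := by
  have h := integ_D i (f * g)
  rw [Derivation.leibniz, smul_eq_mul, smul_eq_mul, map_add, ← eq_sub_iff_add_eq] at h
  rw [h, ← map_sub]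
  congr 1
  ring

theorem integ_mul_lap (φ ψ : SmoothFn) :
    integ (φ * lap ψ) = -integ (grad φ ⬝ᵥ grad ψ) := by
  have hpart : ∀ i, integ (φ * D i (D i ψ)) =
      integ (2 * φ * (coord i * D i ψ)) - integ (D i φ * D i ψ) := fun i => by
    rw [integ_mul_D, ← map_sub]
    congr 1
    ring
  simp only [lap, Finset.mul_sum, map_sum, hpart, Finset.sum_sub_distrib, dotProduct, grad]
  rw [← map_sum, ← Finset.mul_sum, sum_coord_mul_D, mul_zero, map_zero, zero_sub]

theorem integ_nonneg {f : SmoothFn} (h : ∀ x, 0 ≤ f x) : 0 ≤ integ f := integral_nonneg h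

theorem integ_mul_self_nonneg (f : SmoothFn) : 0 ≤ integ (f * f) :=
  integ_nonneg fun x => mul_self_nonneg (f x)

theorem eq_zero_of_integ_mul_self_eq_zero {f : SmoothFn} (h : integ (f * f) = 0) : f = 0 := by
  have : Measure.IsOpenPosMeasure area :=
    inferInstanceAs (Measure.IsOpenPosMeasure (volume : Measure E3).toSphere)
  have hae : ⇑(f * f) =ᵐ[area] fun _ => 0 :=
    (integral_eq_zero_iff_of_nonneg (fun x => mul_self_nonneg (f x)) (integrable_area (f * f))).1 h
  have hzero := ((f * f).contMDiff.continuous.ae_eq_iff_eq area continuous_const).1 hae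
  ext x
  exact mul_self_eq_zero.1 (congrFun hzero x)

theorem eq_of_forall_integ_mul_eq {f g : SmoothFn}
    (h : ∀ φ, integ (φ * f) = integ (φ * g)) : f = g := by
  rw [← sub_eq_zero]
  apply eq_zero_of_integ_mul_self_eq_zero
  rw [mul_sub, map_sub, h, sub_self]

theorem integ_dotProduct_self_eq_zero {a : Fin 3 → SmoothFn} :
    integ (a ⬝ᵥ a) = 0 ↔ a = 0 := by
  refine ⟨fun h => funext fun i => ?_, by rintro rfl; simp⟩
  rw [dotProduct, map_sum,
    Finset.sum_eq_zero_iff_of_nonneg fun i _ => integ_mul_self_nonneg (a i)] at h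
  exact eq_zero_of_integ_mul_self_eq_zero (h i (Finset.mem_univ i))

end Integration

section VectorCalculus

theorem divFree_apply (v : divFree) (f : SmoothFn) :
    (v : Derivation ℝ SmoothFn SmoothFn) f = comp v ⬝ᵥ grad f := v.2.1 f

theorem divFree_ext {v w : divFree} (h : comp v = comp w) : v = w := by
  apply Subtype.ext
  ext1 f
  rw [divFree_apply, divFree_apply, h]

theorem comp_ham (ψ : SmoothFn) : comp (ham ψ) = coord ⨯₃ grad ψ := funext (comp_hamDer ψ)

theorem ham_apply (ψ f : SmoothFn) :
    (ham ψ : Derivation ℝ SmoothFn SmoothFn) f = poisson ψ f := hamDer_apply ψ f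

theorem lie_divFree_apply (v : divFree) (f : SmoothFn) :
    ⁅v, f⁆ = (v : Derivation ℝ SmoothFn SmoothFn) f := rfl

theorem coord_cross_coord_cross {a : Fin 3 → SmoothFn} (ha : coord ⬝ᵥ a = 0) :
    coord ⨯₃ (coord ⨯₃ a) = -a := by
  rw [cross_cross_eq_smul_sub_smul', ha, coord_dotProduct_coord, zero_smul, one_smul, zero_sub]

theorem comp_ham_dotProduct_comp_ham (ψ φ : SmoothFn) :
    comp (ham ψ) ⬝ᵥ comp (ham φ) = grad ψ ⬝ᵥ grad φ := by
  rw [comp_ham, comp_ham, cross_dot_cross, coord_dotProduct_coord, one_mul,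
    dotProduct_comm (grad ψ) coord, coord_dotProduct_grad ψ, mul_zero, sub_zero]

theorem areaForm_ham_right (v : divFree) (f : SmoothFn) :
    areaForm v (ham f) = (v : Derivation ℝ SmoothFn SmoothFn) f := by
  rw [areaForm, triple_product_permutation, comp_ham, cross_cross_eq_smul_sub_smul,
    coord_dotProduct_coord, dotProduct_comm (grad f), coord_dotProduct_grad, zero_smul, sub_zero,
    one_smul, divFree_apply]

theorem poisson_antisymm (f h : SmoothFn) : poisson f h = -poisson h f := by
  rw [poisson, poisson, ← cross_anticomm, dotProduct_neg]

theorem poisson_self (f : SmoothFn) : poisson f f = 0 := by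
  rw [poisson, cross_self, dotProduct_zero]

theorem poisson_add_right (f g h : SmoothFn) : poisson f (g + h) = poisson f g + poisson f h := by
  simp only [← ham_apply, map_add]

theorem poisson_neg_right (f g : SmoothFn) : poisson f (-g) = -poisson f g := by
  simp only [← ham_apply, map_neg]

theorem poisson_sub_right (f g h : SmoothFn) : poisson f (g - h) = poisson f g - poisson f h := by
  simp only [← ham_apply, map_sub]

theorem poisson_smul_right (c : ℝ) (f h : SmoothFn) : poisson f (c • h) = c • poisson f h := by
  simp only [← ham_apply, Derivation.map_smul]

theorem poisson_mul_right (f g h : SmoothFn) :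
    poisson f (g * h) = g * poisson f h + h * poisson f g := by
  simp only [← ham_apply, Derivation.leibniz, smul_eq_mul]

theorem poisson_add_left (f g h : SmoothFn) : poisson (f + g) h = poisson f h + poisson g h := by
  simp only [poisson_antisymm _ h, poisson_add_right, neg_add]

theorem poisson_sub_left (f g h : SmoothFn) : poisson (f - g) h = poisson f h - poisson g h := by
  simp only [poisson_antisymm _ h, poisson_sub_right, neg_sub_neg, neg_sub]

theorem poisson_smul_left (c : ℝ) (f h : SmoothFn) : poisson (c • f) h = c • poisson f h := by
  simp only [poisson_antisymm _ h, poisson_smul_right, smul_neg]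

theorem integ_mul_poisson (f g h : SmoothFn) :
    integ (f * poisson g h) = integ (g * poisson h f) := by
  have e := integ_poisson h (f * g)
  rw [poisson_mul_right, map_add] at e
  rw [poisson_antisymm g h, mul_neg, map_neg]
  linarith

theorem poisson_jacobi (f g h : SmoothFn) :
    poisson f (poisson g h) - poisson g (poisson f h) = poisson (poisson f g) h := by
  have hcocycle := (LieModule.Cohomology.mem_twoCocycle_iff ..).1 cochain_mem
  have e := congrArg (fun T => T (ham f) (ham g) (ham h)) hcocycle
  simp only [LieModule.Cohomology.d₂₃_apply, cochain_apply, areaForm_ham_right,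
    LinearMap.zero_apply, lie_divFree_apply, LieSubalgebra.coe_bracket,
    Derivation.commutator_apply, ham_apply, map_neg] at e
  rw [poisson_antisymm h g, poisson_antisymm h f, poisson_antisymm g f] at e
  simp only [poisson_neg_right] at e
  rw [poisson_antisymm (poisson f g) h]
  linear_combination e

theorem ham_lie_ham (f g : SmoothFn) : ⁅ham f, ham g⁆ = ham (poisson f g) :=
  divFree_ext <| funext fun i => by
    simp only [comp, LieSubalgebra.coe_bracket, Derivation.commutator_apply, ham_apply,
      poisson_jacobi]

end VectorCalculus

section Poincare

variable {E F : Type*} [NormedAddCommGroup E] [NormedAddCommGroup F] [NormedSpace ℝ F]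

theorem exists_primitive_iUnion [NormedSpace ℝ E] {ι : Type*} {U : ι → Set E} {e : E}
    {η : E → E →L[ℝ] F} (hU : ∀ i, IsOpen (U i))
    (hUU : Pairwise fun i j => IsPreconnected (U i ∩ U j))
    (he : ∀ i, e ∈ U i) (hη : ∀ i, ∃ f : E → F, ∀ y ∈ U i, HasFDerivAt f (η y) y) :
    ∃ f : E → F, ∀ y ∈ ⋃ i, U i, HasFDerivAt f (η y) y := by
  classical
  choose f hf using hη
  have hagree : ∀ i j, Set.EqOn (fun y => f i y - f i e) (fun y => f j y - f j e) (U i ∩ U j) := by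
    intro i j
    obtain rfl | hij := eq_or_ne i j
    · exact Set.eqOn_refl _ _
    have hi : ∀ y ∈ U i ∩ U j, HasFDerivAt (fun y => f i y - f i e) (η y) y :=
      fun y hy => (hf i y hy.1).sub_const _
    have hj : ∀ y ∈ U i ∩ U j, HasFDerivAt (fun y => f j y - f j e) (η y) y :=
      fun y hy => (hf j y hy.2).sub_const _
    exact ((hU i).inter (hU j)).eqOn_of_fderiv_eq (𝕜 := ℝ) (hUU hij)
      (fun y hy => (hi y hy).differentiableAt.differentiableWithinAt)
      (fun y hy => (hj y hy).differentiableAt.differentiableWithinAt)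
      (fun y hy => (hi y hy).fderiv.trans (hj y hy).fderiv.symm) ⟨he i, he j⟩ (by simp)
  refine ⟨fun y => if h : ∃ i, y ∈ U i then f h.choose y - f h.choose e else 0, fun y hy => ?_⟩
  obtain ⟨i, hi⟩ := Set.mem_iUnion.1 hy
  refine ((hf i y hi).sub_const (f i e)).congr_of_eventuallyEq ?_
  filter_upwards [(hU i).mem_nhds hi] with z hz
  have hex : ∃ j, z ∈ U j := ⟨i, hz⟩
  rw [dif_pos hex]
  exact hagree _ _ ⟨hex.choose_spec, hz⟩

variable [InnerProductSpace ℝ E]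

/-- The complement of the closed ray spanned by `-e`. -/
def slit (e : E) : Set E := {y | 0 < inner ℝ e y + ‖e‖ * ‖y‖}

theorem isOpen_slit (e : E) : IsOpen (slit e) :=
  isOpen_lt continuous_const (by fun_prop)

theorem slit_inter_slit_neg {e : E} (he : e ≠ 0) :
    slit e ∩ slit (-e) = (Submodule.span ℝ {e} : Set E)ᶜ := by
  ext y
  have hspan : y ∈ Submodule.span ℝ {e} ↔ |inner ℝ e y| = ‖e‖ * ‖y‖ := by
    have h : ‖inner ℝ e y‖ = ‖e‖ * ‖y‖ ↔ e = 0 ∨ y ∈ Submodule.span ℝ {e} :=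
      (norm_inner_eq_norm_tfae ℝ e y).out 0 3
    simpa [he] using h.symm
  simp only [slit, Set.mem_inter_iff, Set.mem_ofPred_eq, Set.mem_compl_iff, SetLike.mem_coe,
    hspan, ← (abs_real_inner_le_norm e y).lt_iff_ne, abs_lt, inner_neg_left, norm_neg]
  constructor <;> rintro ⟨h₁, h₂⟩ <;> constructor <;> linarith

theorem slit_union_slit_neg {e : E} (he : e ≠ 0) : slit e ∪ slit (-e) = {0}ᶜ := by
  ext y
  simp only [slit, Set.mem_union, Set.mem_ofPred_eq, Set.mem_compl_singleton_iff, inner_neg_left,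
    norm_neg]
  constructor
  · rintro h rfl
    simp at h
  · intro hy
    have : 0 < ‖e‖ * ‖y‖ := by positivity
    by_contra! h
    linarith

theorem slit_subset_iUnion_halfSpace (e : E) :
    slit e ⊆ ⋃ n : {n : E // 0 < inner ℝ n e}, {y | 0 < inner ℝ (n : E) y} := by
  intro y hy
  have he0 : e ≠ 0 := by rintro rfl; simp [slit] at hy
  have hy0 : y ≠ 0 := by rintro rfl; simp [slit] at hy
  have hn : inner ℝ (‖e‖ • y + ‖y‖ • e) e = ‖e‖ * (inner ℝ e y + ‖e‖ * ‖y‖) := by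
    rw [inner_add_left, real_inner_smul_left, real_inner_smul_left, real_inner_self_eq_norm_sq,
      real_inner_comm]
    ring
  have hny : inner ℝ (‖e‖ • y + ‖y‖ • e) y = ‖y‖ * (inner ℝ e y + ‖e‖ * ‖y‖) := by
    rw [inner_add_left, real_inner_smul_left, real_inner_smul_left, real_inner_self_eq_norm_sq]
    ring
  exact Set.mem_iUnion.2 ⟨⟨_, hn.symm.subst (mul_pos (norm_pos_iff.2 he0) hy)⟩,
    hny.symm.subst (motive := (0 < ·)) (mul_pos (norm_pos_iff.2 hy0) hy)⟩

variable [CompleteSpace F] {η : E → E →L[ℝ] F}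

theorem exists_primitive_slit (hd : ∀ y ≠ 0, DifferentiableAt ℝ η y)
    (hs : ∀ y ≠ 0, ∀ a b, fderiv ℝ η y a b = fderiv ℝ η y b a) (e : E) :
    ∃ f : E → F, ∀ y ∈ slit e, HasFDerivAt f (η y) y := by
  have hconvex : ∀ n : E, Convex ℝ {y | 0 < inner ℝ n y} := fun n =>
    convex_halfSpace_gt (innerSL ℝ n).isLinear 0
  have hopen : ∀ n : E, IsOpen {y | 0 < inner ℝ n y} := fun n =>
    isOpen_lt continuous_const (by fun_prop)
  have hne : ∀ n y : E, 0 < inner ℝ n y → y ≠ 0 := by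
    rintro n y hy rfl
    simp at hy
  obtain ⟨f, hf⟩ := exists_primitive_iUnion (η := η)
    (U := fun n : {n : E // 0 < inner ℝ n e} => {y | 0 < inner ℝ (n : E) y})
    (fun n => hopen n) (fun n m _ => ((hconvex n).inter (hconvex m)).isPreconnected) Subtype.prop
    fun n => (hconvex n).exists_forall_hasFDerivAt_of_fderiv_symmetric (hopen n)
      (fun y hy => (hd y (hne n y hy)).differentiableWithinAt) (fun y hy => hs y (hne n y hy))
  exact ⟨f, fun y hy => hf y (slit_subset_iUnion_halfSpace e hy)⟩

/-- Two slit spaces cover the punctured space, and their intersection, the complement of a line, is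
connected in dimension at least three. -/
theorem exists_primitive_of_two_lt_rank (hE : 2 < Module.rank ℝ E)
    (hd : ∀ y ≠ 0, DifferentiableAt ℝ η y)
    (hs : ∀ y ≠ 0, ∀ a b, fderiv ℝ η y a b = fderiv ℝ η y b a) :
    ∃ f : E → F, ∀ y ≠ 0, HasFDerivAt f (η y) y := by
  obtain ⟨e, he⟩ := rank_pos_iff_exists_ne_zero.1 (pos_of_gt hE)
  have hcodim : 1 < Module.rank ℝ (E ⧸ Submodule.span ℝ {e}) := by
    by_contra! h
    have hline : Module.rank ℝ (Submodule.span ℝ {e}) ≤ 1 := by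
      simpa using rank_span_le (R := ℝ) {e}
    have hsum := add_le_add h hline
    rw [Submodule.rank_quotient_add_rank, one_add_one_eq_two] at hsum
    exact hE.not_ge hsum
  have hconn : IsConnected (slit e ∩ slit (-e)) :=
    slit_inter_slit_neg he ▸ isConnected_compl_of_one_lt_codim hcodim
  obtain ⟨p, hp⟩ := hconn.nonempty
  have hpunctured : ⋃ b : Bool, cond b (slit e) (slit (-e)) = {0}ᶜ :=
    Set.union_eq_iUnion.symm.trans (slit_union_slit_neg he)
  obtain ⟨f, hf⟩ := exists_primitive_iUnion (U := fun b : Bool => cond b (slit e) (slit (-e)))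
    (by simp [isOpen_slit]) (by
      rintro (_ | _) (_ | _) h <;> first | exact (h rfl).elim | skip
      · exact Set.inter_comm _ _ ▸ hconn.isPreconnected
      · exact hconn.isPreconnected)
    (by simpa [and_comm] using hp) (by simpa using ⟨exists_primitive_slit hd hs (-e),
      exists_primitive_slit hd hs e⟩)
  exact ⟨f, fun y hy => hf y (hpunctured ▸ hy)⟩

end Poincare

section Potential

theorem eq_smul_one_of_grad_eq_zero {f : SmoothFn} (h : grad f = 0) : ∃ c : ℝ, f = c • 1 := by
  have hfderiv : ∀ y ∈ ({0}ᶜ : Set E3), fderiv ℝ (radialExt f) y = 0 := by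
    intro y hy
    refine ContinuousLinearMap.coe_injective
      ((EuclideanSpace.basisFun (Fin 3) ℝ).toBasis.ext fun i => ?_)
    have hi := radialExt_D i f hy
    rw [show D i f = 0 from congrFun h i] at hi
    simpa [radialExt, norm_ne_zero_iff.2 hy, ebasis] using hi.symm
  obtain ⟨c, hc⟩ : ∃ c, ∀ y ∈ ({0}ᶜ : Set E3), radialExt f y = c :=
    isOpen_compl_singleton.exists_is_const_of_fderiv_eq_zero
      (isConnected_compl_singleton_of_one_lt_rank
        (by simp [← Module.finrank_eq_rank]) _).isPreconnected
      (fun y hy => ((contDiffAt_radialExt f hy).differentiableAt (by simp)).differentiableWithinAt)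
      hfderiv
  refine ⟨c, ?_⟩
  ext x
  simpa [radialExt_coe] using hc x (coe_ne_zero x)

theorem eq_zero_of_integ_mul_lap_eq_zero {f : SmoothFn} (h : integ (f * lap f) = 0)
    (h0 : integ f = 0) : f = 0 := by
  rw [integ_mul_lap, neg_eq_zero, integ_dotProduct_self_eq_zero] at h
  obtain ⟨c, rfl⟩ := eq_smul_one_of_grad_eq_zero h
  apply eq_zero_of_integ_mul_self_eq_zero
  rw [smul_mul_assoc, one_mul, map_smul, h0, smul_zero]

theorem hasFDerivAt_inv_norm {E : Type*} [NormedAddCommGroup E] [InnerProductSpace ℝ E] {y : E}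
    (hy : y ≠ 0) : HasFDerivAt (fun z : E => ‖z‖⁻¹) (-(‖y‖⁻¹ ^ 3 • innerSL ℝ y)) y := by
  have hnorm := (hasStrictFDerivAt_norm_sq y).hasFDerivAt.sqrt (by simpa using hy)
  simp only [norm_nonneg, Real.sqrt_sq] at hnorm
  convert! (hasDerivAt_inv (norm_ne_zero_iff.2 hy)).comp_hasFDerivAt y hnorm using 1
  ext z
  simp
  field_simp

theorem D_ofAmbient (i : Fin 3) {g : E3 → ℝ} (hg : ∀ x : S2, ContDiffAt ℝ ∞ g x) (x : S2) :
    D i (ofAmbient g hg) x = fderiv ℝ g x (ebasis i - coord i x • (x : E3)) := by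
  have hx := norm_eq_of_mem_sphere x
  have hnormalize : HasFDerivAt (fun y : E3 => ‖y‖⁻¹ • y) _ (x : E3) :=
    (hasFDerivAt_inv_norm (coe_ne_zero x)).smul (hasFDerivAt_id (x : E3))
  have hgx : HasFDerivAt g (fderiv ℝ g x) (‖(x : E3)‖⁻¹ • (x : E3)) := by
    simpa [hx] using ((hg x).differentiableAt (by simp)).hasFDerivAt
  have hext : radialExt (ofAmbient g hg) =ᶠ[nhds (x : E3)] g ∘ fun y => ‖y‖⁻¹ • y := by
    filter_upwards [isOpen_ne.mem_nhds (coe_ne_zero x)] with y hy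
    exact radialExt_ofAmbient g hg hy
  rw [D_apply, ((HasFDerivAt.comp (f := fun y : E3 => ‖y‖⁻¹ • y) (x : E3) hgx
    hnormalize).congr_of_eventuallyEq hext).fderiv]
  simp [hx, ebasis, coord, EuclideanSpace.inner_single_right, sub_eq_add_neg]

/-- The form `|y|⁻¹ ∑ θᵢ(y / |y|) dyᵢ` on `ℝ³ ∖ {0}`, which for tangential `θ` is the pullback of
the 1-form `∑ θᵢ dxᵢ` on `S²` under `y ↦ y / |y|`. -/
noncomputable def radialForm (θ : Fin 3 → SmoothFn) (y : E3) : E3 →L[ℝ] ℝ :=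
  ∑ i, (‖y‖⁻¹ * radialExt (θ i) y) • EuclideanSpace.proj i

theorem radialForm_ebasis (θ : Fin 3 → SmoothFn) (y : E3) (i : Fin 3) :
    radialForm θ y (ebasis i) = ‖y‖⁻¹ * radialExt (θ i) y := by
  simp [radialForm, ebasis]

theorem radialForm_coe (θ : Fin 3 → SmoothFn) (x : S2) (v : E3) :
    radialForm θ x v = ∑ i, θ i x * v i := by
  simp [radialForm, norm_eq_of_mem_sphere, radialExt_coe]

theorem contDiffAt_radialForm (θ : Fin 3 → SmoothFn) {y : E3} (hy : y ≠ 0) :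
    ContDiffAt ℝ ∞ (radialForm θ) y :=
  ContDiffAt.sum fun i _ => (((contDiffAt_norm ℝ hy).inv (norm_ne_zero_iff.2 hy)).mul
    (contDiffAt_radialExt (θ i) hy)).smul contDiffAt_const

theorem fderiv_radialForm_ebasis (θ : Fin 3 → SmoothFn) {y : E3} (hy : y ≠ 0) (i j : Fin 3) :
    fderiv ℝ (radialForm θ) y (ebasis j) (ebasis i)
      = ‖y‖⁻¹ ^ 2 * radialExt ⇑(D j (θ i) - coord j * θ i) y := by
  have hform : fderiv ℝ (radialForm θ) y (ebasis j) (ebasis i)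
      = fderiv ℝ (fun z => ‖z‖⁻¹ * radialExt (θ i) z) y (ebasis j) := by
    have h := ((contDiffAt_radialForm θ hy).differentiableAt (by simp)).hasFDerivAt.clm_apply
      (hasFDerivAt_const (ebasis i) y)
    simp only [radialForm_ebasis] at h
    simp [h.fderiv]
  have hext := ((contDiffAt_radialExt (θ i) hy).differentiableAt (by simp)).hasFDerivAt
  have hD := radialExt_D j (θ i) hy
  have hn := norm_ne_zero_iff.2 hy
  rw [hform, ((hasFDerivAt_inv_norm hy).fun_mul hext).fderiv]
  simp only [radialExt, hy, ↓reduceDIte] at hD ⊢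
  simp [hD, coord, ebasis, EuclideanSpace.inner_single_right]
  field_simp
  ring

/-- The curl of the restriction to `S²` of a vector field on `ℝ³` that is constant along rays. -/
noncomputable def curl (θ : Fin 3 → SmoothFn) : Fin 3 → SmoothFn :=
  ![D 1 (θ 2) - D 2 (θ 1), D 2 (θ 0) - D 0 (θ 2), D 0 (θ 1) - D 1 (θ 0)]

theorem D_sub_D_of_curl_eq {θ : Fin 3 → SmoothFn} (h : curl θ = coord ⨯₃ θ) (i j : Fin 3) :
    D j (θ i) - D i (θ j) = coord j * θ i - coord i * θ j := by
  have h0 := congrFun h 0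
  have h1 := congrFun h 1
  have h2 := congrFun h 2
  simp only [curl, cross_apply, Matrix.cons_val_zero, Matrix.cons_val_one, Matrix.cons_val]
    at h0 h1 h2
  fin_cases i <;> fin_cases j <;> simp
  · linear_combination -h2
  · linear_combination h1
  · linear_combination h2
  · linear_combination -h0
  · linear_combination -h1
  · linear_combination h0

theorem fderiv_radialForm_symm {θ : Fin 3 → SmoothFn} (h : curl θ = coord ⨯₃ θ) {y : E3}
    (hy : y ≠ 0) (a b : E3) :
    fderiv ℝ (radialForm θ) y a b = fderiv ℝ (radialForm θ) y b a := by
  let T : LinearMap.BilinForm ℝ E3 := (fderiv ℝ (radialForm θ) y).toLinearMap₁₂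
  have hT : T.IsSymm := by
    refine (LinearMap.BilinForm.isSymm_iff_basis
      (EuclideanSpace.basisFun (Fin 3) ℝ).toBasis).2 fun i j => ?_
    have hij := D_sub_D_of_curl_eq h i j
    have hclosed : D j (θ i) - coord j * θ i = D i (θ j) - coord i * θ j := by
      linear_combination hij
    have := fderiv_radialForm_ebasis θ hy j i
    rw [← hclosed, ← fderiv_radialForm_ebasis θ hy i j] at this
    simpa [T, ebasis] using this
  exact hT.eq a b

theorem exists_grad_eq {θ : Fin 3 → SmoothFn} (htangent : coord ⬝ᵥ θ = 0)
    (hclosed : curl θ = coord ⨯₃ θ) : ∃ φ, grad φ = θ := by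
  obtain ⟨F, hF⟩ := exists_primitive_of_two_lt_rank (E := E3)
    (by rw [← Module.finrank_eq_rank, finrank_euclideanSpace_fin]; norm_num)
    (fun y hy => (contDiffAt_radialForm θ hy).differentiableAt (by simp))
    (fun y hy => fderiv_radialForm_symm hclosed hy)
  have hsmooth : ContDiffOn ℝ ∞ F {0}ᶜ :=
    (contDiffOn_infty_iff_fderiv_of_isOpen isOpen_compl_singleton).2
      ⟨fun y hy => (hF y hy).differentiableAt.differentiableWithinAt,
        ContDiffOn.congr (fun y hy => (contDiffAt_radialForm θ hy).contDiffWithinAt)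
          fun y hy => (hF y hy).fderiv⟩
  refine ⟨ofAmbient F fun x =>
    hsmooth.contDiffAt (isOpen_compl_singleton.mem_nhds (coe_ne_zero x)), funext fun i => ?_⟩
  ext x
  have hx : radialForm θ x x = 0 := by
    rw [radialForm_coe]
    simpa [dotProduct, coord, Fin.sum_univ_three, mul_comm] using DFunLike.congr_fun htangent x
  rw [grad, D_ofAmbient, (hF x (coe_ne_zero x)).fderiv, map_sub, map_smul, hx, smul_zero, sub_zero,
    radialForm_ebasis, norm_eq_of_mem_sphere, radialExt_coe, inv_one, one_mul]

theorem curl_cross_coord (a : Fin 3 → SmoothFn) :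
    curl (a ⨯₃ coord) = a + (coord ⬝ᵥ a) • coord - (∑ i, D i (a i)) • coord := by
  have hrad := fun i => sum_coord_mul_D (a i)
  have hx := sum_coord_sq
  simp only [Fin.sum_univ_three] at hrad hx
  funext i
  fin_cases i <;>
    simp [curl, cross_apply, D_coord, Matrix.vec3_dotProduct, Fin.sum_univ_three]
  · linear_combination hrad 0 - a 0 * hx
  · linear_combination hrad 1 - a 1 * hx
  · linear_combination hrad 2 - a 2 * hx

theorem sum_D_comp (v : divFree) : ∑ i, D i (comp v i) = 0 := by
  refine eq_of_forall_integ_mul_eq fun f => ?_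
  have hdiv := v.2.2 f
  rw [divFree_apply, dotProduct, map_sum] at hdiv
  simp only [grad, integ_mul_D] at hdiv
  have htangent : ∑ i, f * (2 * coord i * comp v i - D i (comp v i))
      = -(f * ∑ i, D i (comp v i)) := by
    have h := sum_coord_comp v
    simp only [Fin.sum_univ_three] at h ⊢
    linear_combination 2 * f * h
  rw [← map_sum, htangent, map_neg, neg_eq_zero] at hdiv
  rw [hdiv, mul_zero, map_zero]

theorem exists_eq_ham (v : divFree) : ∃ φ, v = ham φ := by
  have hcross : coord ⨯₃ (comp v ⨯₃ coord) = comp v := by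
    rw [← cross_anticomm coord (comp v), map_neg,
      coord_cross_coord_cross (coord_dotProduct_comp v), neg_neg]
  obtain ⟨φ, hφ⟩ := exists_grad_eq (θ := comp v ⨯₃ coord) (dot_cross_self _ _) (by
    rw [curl_cross_coord, hcross, coord_dotProduct_comp, sum_D_comp, zero_smul, add_zero, sub_zero])
  exact ⟨φ, divFree_ext (by rw [comp_ham, hφ, hcross])⟩

end Potential

section Time

open Classical in
/-- The radial projection `y ↦ y / |y|` of `ℝ³ ∖ {0}` onto `S²`, with a junk value at `0`. -/
noncomputable def radialProj (y : E3) : S2 :=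
  if h : y = 0 then ⟨ebasis 0, by simp [ebasis]⟩ else ⟨‖y‖⁻¹ • y, by simp [norm_smul, h]⟩

theorem radialExt_eq (f : S2 → ℝ) {y : E3} (hy : y ≠ 0) : radialExt f y = f (radialProj y) := by
  simp [radialExt, radialProj, hy]

theorem contMDiffAt_radialProj {y : E3} (hy : y ≠ 0) :
    ContMDiffAt 𝓘(ℝ, E3) (𝓡 2) ∞ radialProj y := by
  have : Fact (Module.finrank ℝ E3 = 2 + 1) := ⟨by simp⟩
  let U : TopologicalSpace.Opens E3 := ⟨{0}ᶜ, isOpen_compl_singleton⟩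
  have hnormalize : ContMDiff 𝓘(ℝ, E3) 𝓘(ℝ, E3) ∞ (fun z : U => ‖(z : E3)‖⁻¹ • (z : E3)) :=
    fun z => (contMDiffAt_subtype_iff (f := fun z : E3 => ‖z‖⁻¹ • z)).2
      (((contDiffAt_norm ℝ z.2).inv (norm_ne_zero_iff.2 z.2)).smul contDiffAt_id).contMDiffAt
  have hsphere := (hnormalize.codRestrict_sphere (n := 2) fun z => by
    simp [norm_smul, show (z : E3) ≠ 0 from z.2]).contMDiffAt (x := (⟨y, hy⟩ : U))
  refine (contMDiffAt_subtype_iff (U := U) (x := ⟨y, hy⟩)).1 (hsphere.congr_of_eventuallyEq ?_)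
  exact .of_forall fun z => by simp [radialProj, show (z : E3) ≠ 0 from z.2, Set.codRestrict]

/-- The radially constant extension `(t, y) ↦ u(t, y / |y|)` of a time-dependent function. -/
noncomputable def timeExt (u : ℝ → SmoothFn) (p : ℝ × E3) : ℝ := radialExt (u p.1) p.2

/-- Joint smoothness of the radially constant extension at the points of `J × (ℝ³ ∖ {0})`. It is
what `SmoothInTime` provides, in terms of derivatives in a vector space. -/
def SmoothExt (J : Set ℝ) (u : ℝ → SmoothFn) : Prop :=
  ∀ t ∈ J, ∀ y : E3, y ≠ 0 → ContDiffAt ℝ ∞ (timeExt u) (t, y)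

variable {J : Set ℝ} {u : ℝ → SmoothFn} {t : ℝ}

theorem SmoothInTime.smoothExt (hJ : IsOpen J) (hu : SmoothInTime J u) : SmoothExt J u := by
  intro t ht y hy
  have hproj : ContMDiffAt 𝓘(ℝ, ℝ × E3) (𝓘(ℝ, ℝ).prod (𝓡 2)) ∞
      (fun p : ℝ × E3 => (p.1, radialProj p.2)) (t, y) :=
    contDiffAt_fst.contMDiffAt.prodMk
      (ContMDiffAt.comp (t, y) (contMDiffAt_radialProj hy) contDiffAt_snd.contMDiffAt)
  have hu' := hu.contMDiffAt ((hJ.prod isOpen_univ).mem_nhds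
    (show (t, radialProj y) ∈ J ×ˢ Set.univ from ⟨ht, trivial⟩))
  refine (hu'.comp (t, y) hproj).contDiffAt.congr_of_eventuallyEq ?_
  filter_upwards [(isOpen_ne.preimage continuous_snd).mem_nhds hy] with p hp
  exact radialExt_eq (u p.1) hp

namespace SmoothExt

theorem D (hJ : IsOpen J) (hu : SmoothExt J u) (i : Fin 3) :
    SmoothExt J (fun t => AxiMHD.D i (u t)) := by
  intro t ht y hy
  have hsmooth : ContDiffAt ℝ ∞
      (fun p : ℝ × E3 => ‖p.2‖ * fderiv ℝ (timeExt u) p (0, ebasis i)) (t, y) :=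
    (contDiffAt_snd.norm ℝ hy).mul
      (((hu t ht y hy).fderiv_right (m := ∞) (by simp)).clm_apply contDiffAt_const)
  refine hsmooth.congr_of_eventuallyEq ?_
  filter_upwards [(hJ.prod isOpen_ne).mem_nhds (show (t, y) ∈ J ×ˢ {z : E3 | z ≠ 0} from ⟨ht, hy⟩)]
    with p hp
  have hslice : HasFDerivAt (radialExt (u p.1))
      ((fderiv ℝ (timeExt u) p).comp (ContinuousLinearMap.inr ℝ ℝ E3)) p.2 :=
    HasFDerivAt.comp (g := timeExt u) (f := fun z : E3 => (p.1, z)) p.2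
      ((hu p.1 hp.1 p.2 hp.2).differentiableAt (by simp)).hasFDerivAt
      (hasFDerivAt_prodMk_right p.1 p.2)
  rw [timeExt, radialExt_D i _ hp.2, hslice.fderiv]
  rfl

theorem add {v : ℝ → SmoothFn} (hu : SmoothExt J u) (hv : SmoothExt J v) :
    SmoothExt J (fun t => u t + v t) := by
  intro t ht y hy
  refine ((hu t ht y hy).add (hv t ht y hy)).congr_of_eventuallyEq (.of_forall fun p => ?_)
  exact congrFun (radialExt_add (u p.1) (v p.1)) p.2

theorem const_smul (c : ℝ) (hu : SmoothExt J u) : SmoothExt J (fun t => c • u t) := by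
  intro t ht y hy
  refine (contDiffAt_const (c := c).smul (hu t ht y hy)).congr_of_eventuallyEq
    (.of_forall fun p => ?_)
  exact congrFun (radialExt_const_smul c (u p.1)) p.2

theorem lap (hJ : IsOpen J) (hu : SmoothExt J u) : SmoothExt J (fun t => AxiMHD.lap (u t)) := by
  have h := fun i => (hu.D hJ i).D hJ i
  simpa only [AxiMHD.lap, Fin.sum_univ_three] using ((h 0).add (h 1)).add (h 2)

theorem contDiffAt_fderiv (hu : SmoothExt J u) (ht : t ∈ J) {y : E3} (hy : y ≠ 0) :
    ContDiffAt ℝ ∞ (fun p => fderiv ℝ (timeExt u) p (1, 0)) (t, y) :=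
  ((hu t ht y hy).fderiv_right (m := ∞) (by simp)).clm_apply contDiffAt_const

/-- The time derivative `∂ₜ u(t, ·)`, as a smooth function on `S²`. -/
noncomputable def timeDeriv (hu : SmoothExt J u) (ht : t ∈ J) : SmoothFn :=
  ofAmbient (fun y => fderiv ℝ (timeExt u) (t, y) (1, 0)) fun x =>
    ContDiffAt.comp (g := fun p => fderiv ℝ (timeExt u) p (1, 0)) (x : E3)
      (hu.contDiffAt_fderiv ht (coe_ne_zero x)) (contDiffAt_const.prodMk contDiffAt_id)

theorem hasDerivAt_apply (hu : SmoothExt J u) (ht : t ∈ J) (x : S2) :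
    HasDerivAt (fun s => u s x) (hu.timeDeriv ht x) t := by
  have h := HasFDerivAt.comp_hasDerivAt (l := timeExt u) (f := fun s : ℝ => (s, (x : E3))) t
    ((hu t ht x (coe_ne_zero x)).differentiableAt (by simp)).hasFDerivAt
    ((hasDerivAt_id t).prodMk (hasDerivAt_const t (x : E3)))
  exact h.congr_of_eventuallyEq (.of_forall fun s => (radialExt_coe (u s) x).symm)

theorem continuousOn_mul_fderiv (hu : SmoothExt J u) (g : SmoothFn) :
    ContinuousOn (fun p : ℝ × S2 => g p.2 * fderiv ℝ (timeExt u) (p.1, (p.2 : E3)) (1, 0))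
      (J ×ˢ Set.univ) := by
  refine (g.contMDiff.continuous.comp continuous_snd).continuousOn.mul fun p hp => ?_
  exact (ContinuousAt.comp (g := fun p => fderiv ℝ (timeExt u) p (1, 0))
    (f := fun p : ℝ × S2 => (p.1, (p.2 : E3)))
    (hu.contDiffAt_fderiv hp.1 (coe_ne_zero p.2)).continuousAt (by fun_prop)).continuousWithinAt

theorem hasDerivAt_integ_mul (hJ : IsOpen J) (hu : SmoothExt J u) (ht : t ∈ J) (g : SmoothFn) :
    HasDerivAt (fun s => integ (g * u s)) (integ (g * hu.timeDeriv ht)) t := by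
  obtain ⟨ε, hε, hεJ⟩ := Metric.nhds_basis_closedBall.mem_iff.1 (hJ.mem_nhds ht)
  have hcont := (hu.continuousOn_mul_fderiv g).mono (Set.prod_mono_left hεJ)
  obtain ⟨C, hC⟩ := ((isCompact_closedBall t ε).prod isCompact_univ).exists_bound_of_continuousOn
    hcont
  refine (hasDerivAt_integral_of_dominated_loc_of_deriv_le (μ := area) (x₀ := t)
    (F := fun s x => (g * u s) x)
    (F' := fun s x => g x * fderiv ℝ (timeExt u) (s, (x : E3)) (1, 0))
    (bound := fun _ => C) (Metric.ball_mem_nhds t hε)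
    (.of_forall fun s => (integrable_area (g * u s)).aestronglyMeasurable)
    (integrable_area (g * u t)) ?_ ?_ (integrable_const C) ?_).2
  · exact (hcont.comp_continuous (f := fun x : S2 => (t, x)) (by fun_prop)
      fun x => ⟨Metric.mem_closedBall_self hε.le, trivial⟩).aestronglyMeasurable
  · exact .of_forall fun x s hs => hC (s, x) ⟨Metric.ball_subset_closedBall hs, trivial⟩
  · exact .of_forall fun x s hs =>
      (hu.hasDerivAt_apply (hεJ (Metric.ball_subset_closedBall hs)) x).const_mul (g x)

theorem forall_hasDerivAt_iff (hJ : IsOpen J) (hu : SmoothExt J u) (ht : t ∈ J) (f : SmoothFn) :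
    (∀ x, HasDerivAt (fun s => u s x) (f x) t) ↔
      ∀ g : SmoothFn, HasDerivAt (fun s => integ (g * u s)) (integ (g * f)) t := by
  have happly := hu.hasDerivAt_apply ht
  have hinteg := hu.hasDerivAt_integ_mul hJ ht
  constructor <;> intro h
  · rwa [show f = hu.timeDeriv ht from DFunLike.ext _ _ fun x => (h x).unique (happly x)]
  · rwa [show f = hu.timeDeriv ht from eq_of_forall_integ_mul_eq fun g => (h g).unique (hinteg g)]

end SmoothExt

end Time

section Weak

theorem inertia_apply (κ : ℝ) (x y : AbelianExt) :
    inertia κ x y = κ * integ (x.fn * y.fn) + integ (comp x.vf ⬝ᵥ comp y.vf) := by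
  rw [← smul_eq_mul, ← map_smul, ← map_add]
  rfl

theorem inertia_mk_ham (κ : ℝ) (ψ q φ τ : SmoothFn) :
    inertia κ (AbelianExt.mk (ham ψ) q) (AbelianExt.mk (ham φ) τ)
      = κ * integ (q * τ) - integ (φ * lap ψ) := by
  rw [inertia_apply, AbelianExt.vf_mk, AbelianExt.vf_mk, comp_ham_dotProduct_comp_ham,
    integ_mul_lap, sub_neg_eq_add, dotProduct_comm]
  rfl

theorem exists_smoothDual_apply_mk_ham (l : smoothDual) : ∃ r c : SmoothFn, ∀ ξ ρ : SmoothFn,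
    (l : Module.Dual ℝ AbelianExt) (AbelianExt.mk (ham ξ) ρ) = integ (r * ρ) + integ (c * ξ) := by
  obtain ⟨l, r, a, h⟩ := l
  refine ⟨r, ∑ i, (2 * coord i * (a ⨯₃ coord) i - D i ((a ⨯₃ coord) i)), fun ξ ρ => ?_⟩
  have hparts : integ (a ⬝ᵥ comp (ham ξ))
      = integ ((∑ i, (2 * coord i * (a ⨯₃ coord) i - D i ((a ⨯₃ coord) i))) * ξ) := by
    rw [comp_ham, triple_product_permutation, triple_product_permutation, dotProduct_comm,
      dotProduct, mul_comm, Finset.mul_sum, map_sum, map_sum]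
    exact Finset.sum_congr rfl fun i _ => integ_mul_D i _ ξ
  rw [h, map_add, ← hparts]
  rfl

theorem lie_mk_ham (ψ σ φ τ : SmoothFn) :
    ⁅AbelianExt.mk (ham ψ) σ, AbelianExt.mk (ham φ) τ⁆
      = AbelianExt.mk (ham (poisson ψ φ)) (poisson ψ τ - poisson φ σ - poisson ψ φ) := by
  simp only [AbelianExt.lie_eq, AbelianExt.vf_mk, AbelianExt.fn_mk, ham_lie_ham, ham_lie,
    areaForm_ham]

theorem pairing_lie (m : MagneticDual) (x y : MagneticExt) :
    pairing m ⁅x, y⁆ = (m.2 : Module.Dual ℝ AbelianExt) ⁅x.fst, y.fst⁆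
      - (y.snd : Module.Dual ℝ AbelianExt) ⁅x.fst, m.1⁆
      + (x.snd : Module.Dual ℝ AbelianExt) ⁅y.fst, m.1⁆ := by
  have hcoadjoint (v : AbelianExt) (l : smoothDual) :
      ((⁅v, l⁆ : smoothDual) : Module.Dual ℝ AbelianExt) m.1
        = -(l : Module.Dual ℝ AbelianExt) ⁅v, m.1⁆ := by
    rw [LieSubmodule.coe_bracket, Module.Dual.lie_apply]
  have hsnd (v : AbelianExt) (k l : smoothDual) : pairing m (MagneticExt.mk v (k - l))
      = (m.2 : Module.Dual ℝ AbelianExt) v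
        + ((k : Module.Dual ℝ AbelianExt) m.1 - (l : Module.Dual ℝ AbelianExt) m.1) := rfl
  have harith (A B C : ℝ) : A + (-B - -C) = A - B + C := by ring
  rw [MagneticExt.lie_eq]
  exact (hsnd _ _ _).trans <|
    (congrArg₂ (fun B C => _ + (B - C)) (hcoadjoint _ _) (hcoadjoint _ _)).trans (harith _ _ _)

/-- The point `((X_ξ, ρ), I_κ (X_ψ, q))` of `F*`; it is `coalgebraFields` for `κ = 1`. -/
noncomputable def dualPoint (κ : ℝ) (ψ ρ q ξ : SmoothFn) : MagneticDual :=
  (AbelianExt.mk (ham ξ) ρ, inertiaOp κ (AbelianExt.mk (ham ψ) q))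

/-- The element `((X_β, α), I_κ (X_δ, γ))` of `F`; it is `algebraFields` for `κ = 1`. -/
noncomputable def algebraPoint (κ : ℝ) (α β γ δ : SmoothFn) : MagneticExt :=
  MagneticExt.mk (AbelianExt.mk (ham β) α) (inertiaOp κ (AbelianExt.mk (ham δ) γ))

/-- `y = ((X_φ, τ), l)` where `l` is the functional `(X_ξ, ρ) ↦ ∫ (r ρ + c ξ) μ`. -/
structure IsTestElement (y : MagneticExt) (φ τ r c : SmoothFn) : Prop where
  fst_eq : y.fst = AbelianExt.mk (ham φ) τ
  snd_apply (ξ ρ : SmoothFn) : (y.snd : Module.Dual ℝ AbelianExt) (AbelianExt.mk (ham ξ) ρ)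
    = integ (r * ρ) + integ (c * ξ)

theorem exists_isTestElement (y : MagneticExt) : ∃ φ τ r c, IsTestElement y φ τ r c := by
  obtain ⟨φ, hφ⟩ := exists_eq_ham y.fst.vf
  obtain ⟨r, c, hrc⟩ := exists_smoothDual_apply_mk_ham y.snd
  exact ⟨φ, y.fst.fn, r, c, by rw [← hφ]; rfl, hrc⟩

theorem isTestElement_algebraPoint (φ τ r χ : SmoothFn) :
    IsTestElement (algebraPoint 1 τ φ r χ) φ τ r (-lap χ) where
  fst_eq := rfl
  snd_apply ξ ρ := (inertia_mk_ham 1 χ r ξ ρ).trans <| by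
    rw [one_mul, neg_mul, map_neg, mul_comm ξ, sub_eq_add_neg]

/-- The value at the test element `((X_φ, τ), (r, c))` of the point of `F*` with vorticity `ζ = Δψ`
and remaining fields `ρ, q, ξ`. -/
noncomputable def testPairing (κ : ℝ) (φ τ r c ζ ρ q ξ : SmoothFn) : ℝ :=
  κ * integ (τ * q) - integ (φ * ζ) + integ (r * ρ) + integ (c * ξ)

/-- The rate of change of the vorticity `Δψ` in the Euler–Arnold equation. -/
noncomputable def vorticityRate (κ : ℝ) (ψ ρ q ξ α γ : SmoothFn) : SmoothFn :=
  poisson (lap ψ) ψ + poisson ξ (lap ξ)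
    + κ • (poisson α q + poisson q ψ + poisson γ ρ + poisson ξ γ)

variable {κ : ℝ} {ψ ρ q ξ : SmoothFn} {y : MagneticExt} {φ τ r c : SmoothFn}

theorem IsTestElement.pairing_dualPoint (hy : IsTestElement y φ τ r c) :
    pairing (dualPoint κ ψ ρ q ξ) y = testPairing κ φ τ r c (lap ψ) ρ q ξ := by
  rw [pairing, hy.fst_eq, dualPoint, hy.snd_apply, inertiaOp, inertia_mk_ham, testPairing,
    mul_comm q τ, add_assoc]

theorem IsTestElement.pairing_dualPoint_lie (hy : IsTestElement y φ τ r c) (α γ : SmoothFn) :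
    pairing (dualPoint κ ψ ρ q ξ) ⁅algebraPoint κ α ψ γ ξ, y⁆
      = testPairing κ φ τ r c (vorticityRate κ ψ ρ q ξ α γ)
        (poisson ρ ψ + poisson ξ α + poisson ψ ξ) (poisson q ψ + poisson ξ γ) (poisson ξ ψ) := by
  have hanti (f g h : SmoothFn) : integ (f * poisson g h) = -integ (f * poisson h g) := by
    rw [poisson_antisymm, mul_neg, map_neg]
  rw [pairing_lie, hy.fst_eq]
  change inertia κ (AbelianExt.mk (ham ψ) q) ⁅AbelianExt.mk (ham ψ) α, _⁆
    - (y.snd : Module.Dual ℝ AbelianExt) ⁅AbelianExt.mk (ham ψ) α, AbelianExt.mk (ham ξ) ρ⁆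
    + inertia κ (AbelianExt.mk (ham ξ) γ) ⁅_, AbelianExt.mk (ham ξ) ρ⁆ = _
  simp only [testPairing, vorticityRate, lie_mk_ham, hy.snd_apply, inertia_mk_ham, mul_add, mul_sub,
    mul_smul_comm, map_add, map_sub, map_smul, smul_eq_mul]
  rw [integ_mul_poisson τ q ψ, integ_mul_poisson q φ α, integ_mul_poisson φ q ψ,
    integ_mul_poisson φ (lap ψ) ψ, mul_comm (poisson φ ξ), integ_mul_poisson (lap ξ) φ ξ,
    integ_mul_poisson γ φ ρ, hanti φ γ ρ, hanti τ ξ γ, integ_mul_poisson τ γ ξ,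
    integ_mul_poisson γ φ ξ, mul_comm (lap ψ), hanti r ρ ψ, hanti c ξ ψ]
  ring

end Weak

section EulerArnold

/-- The partial differential equations expressed, up to the additive constant in `ξ`, by the
Euler–Arnold equation of the curve `dualPoint κ ψ ρ q ξ` driven by `algebraPoint κ α ψ γ ξ`. -/
def SolvesStreamSystem (κ : ℝ) (J : Set ℝ) (ψ ρ q ξ α γ : ℝ → SmoothFn) : Prop :=
  ∀ t ∈ J, ∀ x : S2,
    HasDerivAt (fun s => lap (ψ s) x)
      (vorticityRate κ (ψ t) (ρ t) (q t) (ξ t) (α t) (γ t) x) t ∧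
    HasDerivAt (fun s => ρ s x)
      ((poisson (ρ t) (ψ t) + poisson (ξ t) (α t) + poisson (ψ t) (ξ t)) x) t ∧
    HasDerivAt (fun s => q s x) ((poisson (q t) (ψ t) + poisson (ξ t) (γ t)) x) t ∧
    HasDerivAt (fun s => ξ s x) (poisson (ξ t) (ψ t) x) t

variable {J : Set ℝ} {κ : ℝ} {ψ ρ q ξ α γ : ℝ → SmoothFn}

theorem isEulerArnoldCurve_iff_forall_isTestElement :
    IsEulerArnoldCurve J (fun t => dualPoint κ (ψ t) (ρ t) (q t) (ξ t))
        (fun t => algebraPoint κ (α t) (ψ t) (γ t) (ξ t)) ↔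
      ∀ t ∈ J, ∀ y φ τ r c, IsTestElement y φ τ r c →
        HasDerivAt (fun s => testPairing κ φ τ r c (lap (ψ s)) (ρ s) (q s) (ξ s))
          (testPairing κ φ τ r c (vorticityRate κ (ψ t) (ρ t) (q t) (ξ t) (α t) (γ t))
            (poisson (ρ t) (ψ t) + poisson (ξ t) (α t) + poisson (ψ t) (ξ t))
            (poisson (q t) (ψ t) + poisson (ξ t) (γ t)) (poisson (ξ t) (ψ t))) t := by
  refine forall₂_congr fun t _ => forall_congr' fun y => ?_
  constructor
  · intro h φ τ r c hy
    simpa only [hy.pairing_dualPoint_lie, hy.pairing_dualPoint] using h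
  · intro h
    refine (exists_isTestElement y).elim fun φ ⟨τ, r, c, hy⟩ => ?_
    simpa only [hy.pairing_dualPoint_lie, hy.pairing_dualPoint] using h φ τ r c hy

theorem integ_eq_of_hasDerivAt_poisson (hJ : IsOpen J) (hJ' : IsPreconnected J)
    (hξ : SmoothExt J ξ)
    (h : ∀ t ∈ J, ∀ x, HasDerivAt (fun s => ξ s x) (poisson (ξ t) (ψ t) x) t) :
    ∀ s ∈ J, ∀ t ∈ J, integ (ξ s) = integ (ξ t) := by
  have hderiv : ∀ t ∈ J, HasDerivAt (fun s => integ (ξ s)) 0 t := by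
    intro t ht
    simpa only [one_mul, integ_poisson] using (hξ.forall_hasDerivAt_iff hJ ht _).1 (h t ht) 1
  intro s hs t ht
  exact hJ.is_const_of_deriv_eq_zero hJ'
    (fun z hz => (hderiv z hz).differentiableAt.differentiableWithinAt)
    (fun z hz => (hderiv z hz).deriv) hs ht

theorem hasDerivAt_of_forall_integ_lap_mul (hJ : IsOpen J) (hξ : SmoothExt J ξ)
    (hmean : ∀ s ∈ J, ∀ t ∈ J, integ (ξ s) = integ (ξ t)) {t : ℝ} (ht : t ∈ J) {f : SmoothFn}
    (hf : integ f = 0)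
    (h : ∀ χ, HasDerivAt (fun s => integ (lap χ * ξ s)) (integ (lap χ * f)) t) (x : S2) :
    HasDerivAt (fun s => ξ s x) (f x) t := by
  have hinteg := hξ.hasDerivAt_integ_mul hJ ht
  have hmean_deriv : integ (hξ.timeDeriv ht) = 0 := by
    have hone := hinteg 1
    simp only [one_mul] at hone
    refine hone.unique ((hasDerivAt_const t (integ (ξ t))).congr_of_eventuallyEq ?_)
    filter_upwards [hJ.mem_nhds ht] with s hs
    exact hmean s hs t ht
  have heq : hξ.timeDeriv ht - f = 0 := by
    refine eq_zero_of_integ_mul_lap_eq_zero ?_ (by rw [map_sub, hmean_deriv, hf, sub_zero])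
    rw [mul_comm, mul_sub, map_sub, (hinteg _).unique (h _), sub_self]
  rw [← sub_eq_zero.1 heq]
  exact hξ.hasDerivAt_apply ht x

theorem SolvesStreamSystem.isEulerArnoldCurve (hJ : IsOpen J) (hψ : SmoothExt J ψ)
    (hρ : SmoothExt J ρ) (hq : SmoothExt J q) (hξ : SmoothExt J ξ)
    (h : SolvesStreamSystem κ J ψ ρ q ξ α γ) :
    IsEulerArnoldCurve J (fun t => dualPoint κ (ψ t) (ρ t) (q t) (ξ t))
      (fun t => algebraPoint κ (α t) (ψ t) (γ t) (ξ t)) := by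
  refine isEulerArnoldCurve_iff_forall_isTestElement.2 fun t ht y φ τ r c _ => ?_
  have hlap := ((hψ.lap hJ).forall_hasDerivAt_iff hJ ht _).1 (fun x => (h t ht x).1) φ
  have hρ' := (hρ.forall_hasDerivAt_iff hJ ht _).1 (fun x => (h t ht x).2.1) r
  have hq' := (hq.forall_hasDerivAt_iff hJ ht _).1 (fun x => (h t ht x).2.2.1) τ
  have hξ' := (hξ.forall_hasDerivAt_iff hJ ht _).1 (fun x => (h t ht x).2.2.2) c
  exact (((hq'.const_mul κ).sub hlap).add hρ').add hξ'

theorem solvesStreamSystem_of_isEulerArnoldCurve (hJ : IsOpen J) (hκ : κ ≠ 0)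
    (hψ : SmoothExt J ψ) (hρ : SmoothExt J ρ) (hq : SmoothExt J q) (hξ : SmoothExt J ξ)
    (hmean : ∀ s ∈ J, ∀ t ∈ J, integ (ξ s) = integ (ξ t))
    (h : IsEulerArnoldCurve J (fun t => dualPoint κ (ψ t) (ρ t) (q t) (ξ t))
      (fun t => algebraPoint κ (α t) (ψ t) (γ t) (ξ t))) :
    SolvesStreamSystem κ J ψ ρ q ξ α γ := by
  intro t ht
  have htest (φ τ r χ : SmoothFn) := isEulerArnoldCurve_iff_forall_isTestElement.1 h t ht _ φ τ r _
    (isTestElement_algebraPoint φ τ r χ)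
  have hlap0 : lap 0 = 0 := by simp [lap]
  simp only [testPairing] at htest
  refine fun x => ⟨((hψ.lap hJ).forall_hasDerivAt_iff hJ ht _).2 (fun g => ?_) x,
    (hρ.forall_hasDerivAt_iff hJ ht _).2 (fun g => ?_) x,
    (hq.forall_hasDerivAt_iff hJ ht _).2 (fun g => ?_) x,
    hasDerivAt_of_forall_integ_lap_mul hJ hξ hmean ht (integ_poisson _ _) (fun g => ?_) x⟩
  · simpa only [hlap0, neg_zero, zero_mul, map_zero, mul_zero, zero_sub, add_zero, neg_neg]
      using (htest g 0 0 0).fun_neg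
  · simpa only [hlap0, neg_zero, zero_mul, map_zero, mul_zero, sub_zero, add_zero, zero_add]
      using htest 0 0 g 0
  · simpa only [hlap0, neg_zero, zero_mul, map_zero, mul_zero, sub_zero, add_zero,
      inv_mul_cancel_left₀ hκ] using (htest 0 g 0 0).const_mul κ⁻¹
  · simpa only [neg_mul, zero_mul, map_zero, map_neg, mul_zero, sub_zero, zero_add, neg_neg]
      using (htest 0 0 0 g).fun_neg

theorem solvesStreamSystem_iff (hJ : IsOpen J) (hJ' : IsPreconnected J) (hκ : κ ≠ 0)
    (hψ : SmoothExt J ψ) (hρ : SmoothExt J ρ) (hq : SmoothExt J q) (hξ : SmoothExt J ξ) :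
    SolvesStreamSystem κ J ψ ρ q ξ α γ ↔
      IsEulerArnoldCurve J (fun t => dualPoint κ (ψ t) (ρ t) (q t) (ξ t))
        (fun t => algebraPoint κ (α t) (ψ t) (γ t) (ξ t)) ∧
      ∀ s ∈ J, ∀ t ∈ J, integ (ξ s) = integ (ξ t) :=
  ⟨fun h => ⟨h.isEulerArnoldCurve hJ hψ hρ hq hξ,
      integ_eq_of_hasDerivAt_poisson hJ hJ' hξ fun t ht x => (h t ht x).2.2.2⟩,
    fun h => solvesStreamSystem_of_isEulerArnoldCurve hJ hκ hψ hρ hq hξ h.2 h.1⟩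

end EulerArnold

section Legendre

variable {V : Type*} [AddCommGroup V] [Module ℝ V] (B : V →ₗ[ℝ] Module.Dual ℝ V)

/-- The Legendre transform of the quadratic form `v ↦ ½ B(v, v)`. It is meaningful only at `b` for
which the supremum is finite, since an unbounded `⨆` in `ℝ` is `0`. -/
noncomputable def legendre (b : Module.Dual ℝ V) : ℝ :=
  ⨆ v, (b v - 1 / 2 * B v v)

variable {B}

theorem legendre_zero (hB : ∀ v, 0 ≤ B v v) : legendre B 0 = 0 := by
  have hle (v : V) : (0 : Module.Dual ℝ V) v - 1 / 2 * B v v ≤ 0 := by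
    rw [LinearMap.zero_apply]
    linarith [hB v]
  exact le_antisymm (ciSup_le hle)
    (le_ciSup_of_le ⟨0, Set.forall_mem_range.2 hle⟩ 0 (by simp))

theorem legendre_smul (hB : ∀ v, 0 ≤ B v v) (s : ℝ) (b : Module.Dual ℝ V) :
    legendre B (s • b) = s ^ 2 * legendre B b := by
  obtain rfl | hs := eq_or_ne s 0
  · simp [legendre_zero hB]
  rw [legendre, legendre, Real.mul_iSup_of_nonneg (sq_nonneg s),
    ← (Equiv.smulRight hs).surjective.iSup_comp]
  congr 1
  funext v
  simp only [Equiv.smulRight_apply, map_smul, LinearMap.smul_apply, smul_eq_mul]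
  ring

theorem legendre_add (hB : ∀ u v, B u v = B v u) {b : Module.Dual ℝ V}
    (hb : BddAbove (Set.range fun v => b v - 1 / 2 * B v v)) (u : V) :
    legendre B (B u + b) = 1 / 2 * B u u + b u + legendre B b := by
  rw [legendre, legendre, add_ciSup hb, ← (Equiv.addLeft u).surjective.iSup_comp]
  congr 1
  funext v
  simp only [Equiv.coe_addLeft, map_add, LinearMap.add_apply, hB v u]
  ring

theorem legendre_apply (hB : ∀ u v, B u v = B v u) (hB' : ∀ v, 0 ≤ B v v) (u : V) :
    legendre B (B u) = 1 / 2 * B u u := by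
  have hbdd : BddAbove (Set.range fun v => (0 : Module.Dual ℝ V) v - 1 / 2 * B v v) := by
    refine ⟨0, Set.forall_mem_range.2 fun v => ?_⟩
    rw [LinearMap.zero_apply]
    linarith [hB' v]
  simpa only [add_zero, legendre_zero hB', LinearMap.zero_apply] using legendre_add hB hbdd u

end Legendre

section LiePoisson

theorem inertia_comm (κ : ℝ) (x y : AbelianExt) : inertia κ x y = inertia κ y x := by
  rw [inertia_apply, inertia_apply, mul_comm x.fn, dotProduct_comm]

theorem inertia_self_nonneg {κ : ℝ} (hκ : 0 ≤ κ) (x : AbelianExt) : 0 ≤ inertia κ x x := by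
  rw [inertia_apply, dotProduct, map_sum]
  exact add_nonneg (mul_nonneg hκ (integ_mul_self_nonneg _))
    (Finset.sum_nonneg fun i _ => integ_mul_self_nonneg _)

theorem inertia_self_eq_zero {κ : ℝ} (hκ : 0 < κ) {x : AbelianExt} :
    inertia κ x x = 0 ↔ x = 0 := by
  refine ⟨fun h => ?_, fun h => by rw [h, map_zero]⟩
  have hdot : 0 ≤ integ (comp x.vf ⬝ᵥ comp x.vf) := by
    rw [dotProduct, map_sum]
    exact Finset.sum_nonneg fun i _ => integ_mul_self_nonneg _
  rw [inertia_apply, add_eq_zero_iff_of_nonneg (mul_nonneg hκ.le (integ_mul_self_nonneg _)) hdot,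
    mul_eq_zero_iff_left hκ.ne', integ_dotProduct_self_eq_zero] at h
  have hx : x = AbelianExt.mk x.vf x.fn := rfl
  rw [hx, eq_zero_of_integ_mul_self_eq_zero h.1, divFree_ext (v := x.vf) (w := 0) h.2]
  rfl

theorem bddAbove_range_sub_inertia {κ : ℝ} (hκ : 0 < κ) (b : smoothDual) :
    BddAbove (Set.range fun v : AbelianExt =>
      (b : Module.Dual ℝ AbelianExt) v - 1 / 2 * inertia κ v v) := by
  obtain ⟨b, r, a, h⟩ := b
  refine ⟨1 / 2 * (κ⁻¹ * integ (r * r) + integ (a ⬝ᵥ a)), Set.forall_mem_range.2 fun v => ?_⟩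
  have hsquare : 0 ≤ κ⁻¹ * integ ((r - κ • v.fn) * (r - κ • v.fn))
      + integ ((a - comp v.vf) ⬝ᵥ (a - comp v.vf)) := by
    rw [dotProduct, map_sum]
    exact add_nonneg (mul_nonneg (inv_nonneg.2 hκ.le) (integ_mul_self_nonneg _))
      (Finset.sum_nonneg fun i _ => integ_mul_self_nonneg _)
  have hb : b v = integ (r * v.fn) + integ (a ⬝ᵥ comp v.vf) := by
    rw [h, map_add]
    rfl
  change b v - _ ≤ _
  rw [hb, inertia_apply]
  simp only [sub_mul, mul_sub, smul_mul_assoc, mul_smul_comm, sub_dotProduct, dotProduct_sub,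
    map_sub, map_smul, smul_eq_mul, mul_comm v.fn, dotProduct_comm (comp v.vf) a] at hsquare
  field_simp at hsquare ⊢
  linarith

theorem hamiltonian_inertiaOp (w u : AbelianExt) :
    hamiltonian (w, inertiaOp 4 u) = 1 / 2 * inertia 4 w w + 1 / 2 * inertia 4 u u :=
  congrArg (1 / 2 * inertia 4 w w + ·)
    (legendre_apply (inertia_comm 4) (inertia_self_nonneg zero_le_four) u)

theorem hamiltonian_inertiaOp_add (w u : AbelianExt) (δ : MagneticDual) (s : ℝ) :
    hamiltonian ((w, inertiaOp 4 u) + s • δ)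
      = 1 / 2 * inertia 4 w w + 1 / 2 * inertia 4 u u
        + s * ((δ.2 : Module.Dual ℝ AbelianExt) u + inertia 4 w δ.1)
        + s ^ 2 * hamiltonian δ := by
  have hfst : inertia 4 (w + s • δ.1) (w + s • δ.1)
      = inertia 4 w w + 2 * s * inertia 4 w δ.1 + s ^ 2 * inertia 4 δ.1 δ.1 := by
    simp only [map_add, map_smul, LinearMap.add_apply, LinearMap.smul_apply, smul_eq_mul,
      inertia_comm 4 δ.1 w]
    ring
  have hsnd : legendre (inertia 4) (inertia 4 u + s • (δ.2 : Module.Dual ℝ AbelianExt))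
      = 1 / 2 * inertia 4 u u + s * (δ.2 : Module.Dual ℝ AbelianExt) u
        + s ^ 2 * legendre (inertia 4) (δ.2 : Module.Dual ℝ AbelianExt) := by
    rw [← legendre_smul (inertia_self_nonneg zero_le_four)]
    exact legendre_add (inertia_comm 4) (bddAbove_range_sub_inertia zero_lt_four (s • δ.2)) u
  have harith (A B C E F G : ℝ) :
      1 / 2 * (A + 2 * s * B + s ^ 2 * C) + (1 / 2 * E + s * F + s ^ 2 * G)
        = 1 / 2 * A + 1 / 2 * E + s * (F + B) + s ^ 2 * (1 / 2 * C + G) := by ring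
  exact (congrArg₂ (fun a b : ℝ => 1 / 2 * a + b) hfst hsnd).trans (harith _ _ _ _ _ _)

theorem isDifferentialAt_hamiltonian (w u : AbelianExt) :
    IsDifferentialAt hamiltonian (w, inertiaOp 4 u) (MagneticExt.mk u (inertiaOp 4 w)) := by
  intro δ
  have hquad (c a b : ℝ) : HasDerivAt (fun s : ℝ => c + s * a + s ^ 2 * b) a 0 := by
    simpa using! (((hasDerivAt_id (0 : ℝ)).mul_const a).const_add c).add
      (((hasDerivAt_id (0 : ℝ)).pow 2).mul_const b)
  exact (hquad _ _ _).congr_of_eventuallyEq (.of_forall (hamiltonian_inertiaOp_add w u δ))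

theorem magneticExt_ext_of_pairing {x y : MagneticExt} (h : ∀ δ, pairing δ x = pairing δ y) :
    x = y := by
  have hsnd : x.snd = y.snd := by
    refine Subtype.ext (LinearMap.ext fun v => ?_)
    exact (zero_add _).symm.trans ((h (v, 0)).trans (zero_add _))
  have hfst : x.fst - y.fst = 0 := by
    refine (inertia_self_eq_zero one_pos).1 ?_
    have hdual : inertia 1 (x.fst - y.fst) x.fst + (x.snd : Module.Dual ℝ AbelianExt) 0
      = inertia 1 (x.fst - y.fst) y.fst + (y.snd : Module.Dual ℝ AbelianExt) 0 :=
      h (0, inertiaOp 1 (x.fst - y.fst))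
    rw [map_zero, map_zero, add_zero, add_zero] at hdual
    rw [map_sub (inertia 1 (x.fst - y.fst)), hdual, sub_self]
  have hmk (z : MagneticExt) : z = MagneticExt.mk z.fst z.snd := rfl
  rw [hmk x, hmk y, hsnd, sub_eq_zero.1 hfst]

theorem IsDifferentialAt.unique {h : MagneticDual → ℝ} {m : MagneticDual} {x y : MagneticExt}
    (hx : IsDifferentialAt h m x) (hy : IsDifferentialAt h m y) : x = y :=
  magneticExt_ext_of_pairing fun δ => (hx δ).unique (hy δ)

theorem isLiePoissonCurve_hamiltonian_iff (J : Set ℝ) (w u : ℝ → AbelianExt) :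
    IsLiePoissonCurve hamiltonian J (fun t => (w t, inertiaOp 4 (u t))) ↔
      IsEulerArnoldCurve J (fun t => (w t, inertiaOp 4 (u t)))
        (fun t => MagneticExt.mk (u t) (inertiaOp 4 (w t))) := by
  constructor
  · rintro ⟨x, hx, h⟩ t ht y
    have hxt := (hx t ht).unique (isDifferentialAt_hamiltonian (w t) (u t))
    exact (h t ht y).congr_deriv
      (congrArg (fun z => pairing (w t, inertiaOp 4 (u t)) ⁅z, y⁆) hxt)
  · exact fun h => ⟨_, fun t _ => isDifferentialAt_hamiltonian _ _, h⟩

theorem hamiltonian_momentum (ψ ρ q ξ : SmoothFn) :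
    hamiltonian (momentum ψ ρ q ξ) = energy ψ ρ q ξ := by
  rw [momentum, hamiltonian_inertiaOp, inertia_mk_ham, inertia_mk_ham, energy]
  simp only [smul_mul_smul_comm, map_smul, map_sub, smul_eq_mul, sq]
  ring

end LiePoisson

section Main

variable {J : Set ℝ} {ψ ρ q ξ : ℝ → SmoothFn}

theorem hasDerivAt_half_smul_iff {u : ℝ → SmoothFn} {f g : SmoothFn} (h : f = (1 / 2 : ℝ) • g)
    {x : S2} {t : ℝ} : HasDerivAt (fun s => ((1 / 2 : ℝ) • u s) x) (f x) t ↔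
      HasDerivAt (fun s => u s x) (g x) t := by
  subst h
  exact ⟨fun h => by simpa using h.const_mul 2, fun h => by simpa using h.const_mul (1 / 2 : ℝ)⟩

theorem half_smul_two_mul (f : SmoothFn) : (1 / 2 : ℝ) • (2 * f) = f := by
  rw [two_mul]
  module

theorem solvesAxisymmetricMHD_iff_half :
    SolvesAxisymmetricMHD J ψ ρ q ξ ↔
      SolvesStreamSystem 4 J ψ (fun t => (1 / 2 : ℝ) • ρ t) (fun t => (1 / 2 : ℝ) • q t) ξ
        (fun t => (1 / 2 : ℝ) • q t) (fun t => (1 / 2 : ℝ) • ρ t) := by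
  refine forall₂_congr fun t _ => forall_congr' fun x =>
    and_congr ?_ (and_congr ?_ (and_congr ?_ Iff.rfl))
  · have hrate : vorticityRate 4 (ψ t) ((1 / 2 : ℝ) • ρ t) ((1 / 2 : ℝ) • q t) (ξ t)
          ((1 / 2 : ℝ) • q t) ((1 / 2 : ℝ) • ρ t)
        = poisson (lap (ψ t)) (ψ t) + poisson (ξ t) (lap (ξ t)) + 2 * poisson (q t) (ψ t)
          + 2 * poisson (ξ t) (ρ t) := by
      rw [vorticityRate, two_mul, two_mul]
      simp only [poisson_self, poisson_smul_left, poisson_smul_right]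
      module
    rw [hrate]
  · refine (hasDerivAt_half_smul_iff ?_).symm
    rw [poisson_smul_left, poisson_smul_right, smul_add, smul_add, half_smul_two_mul]
  · refine (hasDerivAt_half_smul_iff ?_).symm
    rw [poisson_smul_left, poisson_smul_right, smul_add]

theorem solvesAxisymmetricMHD_iff :
    SolvesAxisymmetricMHD J ψ ρ q ξ ↔
      SolvesStreamSystem 1 J ψ ρ q ξ (fun t => q t - ψ t) (fun t => ρ t + ξ t) := by
  refine forall₂_congr fun t _ => forall_congr' fun x => ?_
  have hψ : vorticityRate 1 (ψ t) (ρ t) (q t) (ξ t) (q t - ψ t) (ρ t + ξ t)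
      = poisson (lap (ψ t)) (ψ t) + poisson (ξ t) (lap (ξ t)) + 2 * poisson (q t) (ψ t)
        + 2 * poisson (ξ t) (ρ t) := by
    rw [vorticityRate, one_smul, poisson_sub_left, poisson_add_left, poisson_add_right,
      poisson_self, poisson_self, poisson_self, poisson_antisymm (ψ t) (q t)]
    ring
  have hρ : poisson (ρ t) (ψ t) + poisson (ξ t) (q t - ψ t) + poisson (ψ t) (ξ t)
      = poisson (ρ t) (ψ t) + poisson (ξ t) (q t) + 2 * poisson (ψ t) (ξ t) := by
    rw [poisson_sub_right, poisson_antisymm (ξ t) (ψ t)]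
    ring
  have hq : poisson (q t) (ψ t) + poisson (ξ t) (ρ t + ξ t)
      = poisson (q t) (ψ t) + poisson (ξ t) (ρ t) := by
    rw [poisson_add_right, poisson_self, add_zero]
  rw [hψ, hρ, hq]

end Main

end AxiMHD

theorem mainTheorem1 (J : Set ℝ) (hJ : IsOpen J) (hJ' : J.OrdConnected)
    (ψ ρ q ξ : ℝ → AxiMHD.SmoothFn)
    (hψ : AxiMHD.SmoothInTime J ψ) (hρ : AxiMHD.SmoothInTime J ρ)
    (hq : AxiMHD.SmoothInTime J q) (hξ : AxiMHD.SmoothInTime J ξ) :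
    (AxiMHD.SolvesAxisymmetricMHD J ψ ρ q ξ ↔
      AxiMHD.IsLiePoissonCurve AxiMHD.hamiltonian J
        (fun t => AxiMHD.momentum (ψ t) (ρ t) (q t) (ξ t)) ∧
      ∀ s ∈ J, ∀ t ∈ J, AxiMHD.integ (ξ s) = AxiMHD.integ (ξ t)) ∧
    (∀ t ∈ J, AxiMHD.hamiltonian (AxiMHD.momentum (ψ t) (ρ t) (q t) (ξ t)) =
      AxiMHD.energy (ψ t) (ρ t) (q t) (ξ t)) ∧
    (AxiMHD.SolvesAxisymmetricMHD J ψ ρ q ξ ↔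
      AxiMHD.IsEulerArnoldCurve J
        (fun t => AxiMHD.coalgebraFields (ψ t) (ρ t) (q t) (ξ t))
        (fun t => AxiMHD.algebraFields (q t - ψ t) (ψ t) (ρ t + ξ t) (ξ t)) ∧
      ∀ s ∈ J, ∀ t ∈ J, AxiMHD.integ (ξ s) = AxiMHD.integ (ξ t)) := by
  have hψ' := hψ.smoothExt hJ
  have hρ' := hρ.smoothExt hJ
  have hq' := hq.smoothExt hJ
  have hξ' := hξ.smoothExt hJ
  refine ⟨?_, fun t _ => AxiMHD.hamiltonian_momentum _ _ _ _, ?_⟩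
  · rw [AxiMHD.solvesAxisymmetricMHD_iff_half, AxiMHD.solvesStreamSystem_iff hJ
      hJ'.isPreconnected four_ne_zero hψ' (hρ'.const_smul (1 / 2)) (hq'.const_smul (1 / 2)) hξ']
    exact and_congr_left' (AxiMHD.isLiePoissonCurve_hamiltonian_iff J _ _).symm
  · exact AxiMHD.solvesAxisymmetricMHD_iff.trans
      (AxiMHD.solvesStreamSystem_iff hJ hJ'.isPreconnected one_ne_zero hψ' hρ' hq' hξ')
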